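/- **Setting.** A concept class $\mathcal F$ consists, for every $n\in\mathbb N$, of functions $f^\alpha:\{0,1\}^n\to\{0,1\}$ labeled by the strings $\alpha$ of a nonempty set $\Lambda_n\subseteq\{0,1\}^{m(n)}$, with $m(n)$ polynomially bounded. It is *$c$-distinct* if for all $n$ and all $\alpha_1\ne\alpha_2$ in $\Lambda_n$ there is $S\subseteq\{0,1\}^n$ with $|S|/2^n\ge c$ and $f^{\alpha_1}(x)\neq f^{\alpha_2}(x)$ for all $x\in S$. Put $d(\alpha,\alpha')=\mathbb E_{x\sim\mathrm{Unif}(\{0,1\}^n)}|f^{\alpha}(x)-f^{\alpha'}(x)|$. A dataset is a finite sequence $T$ of $|T|$ pairs $(x,y)\in\{0,1\}^n\times\{0,1\}$; it is called a set if its pairs are pairwise distinct. The parameters are rational $\epsilon>0$ and $\beta\geq 1$ (given to algorithms with numerator and denominator in unary) and real $\delta\in(0,1)$. A random string $r$ is uniform in $R=\{0,1\}^{\rho}$, where $\rho$ is a fixed polynomial in the size of the other inputs (number of samples $|T|$, $n$, and the numerators and denominators of the rational parameters). A sample size is *polynomial* if it is bounded by a polynomial in $n,1/\epsilon,1/\delta$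 (and $\beta$, where there is one). An algorithm is a *proper PAC learner* with sample size $B(n,\epsilon,\delta)$ if for all $n,\epsilon,\delta$, $\alpha\in\Lambda_n$ and $N\ge B(n,\epsilon,\delta)$, when $T$ consists of $N$ independent uniform inputs $x_\ell\in\{0,1\}^n$ with labels $f^\alpha(x_\ell)$, it outputs, with probability at least $1-\delta$ over $T$ and $r$, some $\tilde\alpha\in\Lambda_n$ with $d(\alpha,\tilde\alpha)\le\epsilon$. An *approximate-correct identification algorithm* with polynomial sample size $B(n,\epsilon,\delta)$ is a polynomial-time algorithm $\mathcal A(T,\epsilon,r)\in\{0,1\}^{m(n)}$ that is a proper PAC learner with sample size $B$, outputs an element of $\Lambda_n$ whenever $|T|\ge B(n,\epsilon,\delta)$, and for which there are $\epsilon_1(n),\epsilon_2(n)>0$, at most inverse polynomially small in $n$, such that, whenever $|T|\geq B(n,\epsilon,\delta)$ and $\alpha\in\Lambda_n$: 1. if $T$ is a set, $y\ne f^\alpha(x)$ for all $(x,y)\in T$ and $\epsilon\le\epsilon_1(n)$, then $\mathcal A(T,\epsilon,r)\neq\alpha$ for all $r\in R$; 2. if the inputs in $T$ are pairwise distinct,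 $y=f^\alpha(x)$ for all $(x,y)\in T$ and $\epsilon\le\epsilon_2(n)$, then $d(\alpha,\mathcal A(T,\epsilon,r))\le\frac13$ for at least one $r\in R$. An *approximate-verifiable identification algorithm in $\mathsf{NP}$* with polynomial sample size $B'(\beta,n,\epsilon,\delta)$ is an algorithm $\mathcal A^\beta(T,\epsilon,r)$, running in polynomial time with access to an oracle for some language in $\mathsf{NP}$ ($\beta$ being part of its input), that outputs a string in $\{0,1\}^{m(n)}$ or "invalid dataset", such that for every $\beta\geq1$ it is a proper PAC learner with sample size $B'(\beta,\cdot,\cdot,\cdot)$, and for every set $T$ with $|T|\ge B'(\beta,n,\epsilon,\delta)$: * (Soundness) if $\mathcal A^\beta(T,\epsilon,r)=\alpha$ for some $r\in R$, then $\alpha\in\Lambda_n$ and $y=f^\alpha(x)$ for all $(x,y)$ in some $T'\subseteq T$ with $|T'|\ge(1-\frac1\beta)|T|$ (in particular the output is "invalid dataset" if no concept is consistent with such a $T'$); * (Completeness) if $\alpha\in\Lambda_n$, $y=f^\alpha(x)$ for all $(x,y)\in T$, and $\epsilon\ge\frac13$, then $\mathcal A^\beta(T,\epsilon,r)=\alpha$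 for some $r\in R$. **Theorem.** Let $\mathcal F$ be a $c$-distinct concept class with $c\ge\frac13$. If there is an approximate-correct identification algorithm for $\mathcal F$ with polynomial sample size $B(n,\epsilon,\delta)$, then there are $\epsilon_c(n)>0$, at most inverse polynomially small in $n$, and an approximate-verifiable identification algorithm in $\mathsf{NP}$ for $\mathcal F$ that works for datasets of size $\beta B$, namely with sample size $B'(\beta,n,\epsilon,\delta)=\lceil\beta\,B(n,\min(\epsilon,\epsilon_c(n)),\delta)\rceil$. -/

import Mathlib

/-! ### A step-counted machine model with oracles -/

/-- Programs of a multi-stack machine. There are registers `0, 1, 2, …`, each holding a stack of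
bits; a program only mentions finitely many of them. -/
inductive Prog : Type
  /-- do nothing -/
  | skip : Prog
  /-- push the bit `b` onto register `i` -/
  | push (i : ℕ) (b : Bool) : Prog
  /-- remove the top bit of register `i`, if there is one -/
  | pop (i : ℕ) : Prog
  /-- ask the oracle about the content of register `i`, and replace it by the one-bit answer -/
  | query (i : ℕ) : Prog
  /-- first `p`, then `q` -/
  | seq (p q : Prog) : Prog
  /-- three-way test of the top of register `i`: empty, `false`, `true` -/
  | branch (i : ℕ) (pEmpty pFalse pTrue : Prog) : Prog
  /-- while register `i` is nonempty, do `p` -/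
  | loop (i : ℕ) (p : Prog) : Prog

/-- `Runs O P s s' t`: with the oracle `O`, the program `P` started on the register contents `s`
halts after exactly `t` elementary steps with the register contents `s'`. -/
inductive Runs (O : Set (List Bool)) :
    Prog → (ℕ → List Bool) → (ℕ → List Bool) → ℕ → Prop
  | skip (s : ℕ → List Bool) : Runs O .skip s s 1
  | push (i : ℕ) (b : Bool) (s : ℕ → List Bool) :
      Runs O (.push i b) s (Function.update s i (b :: s i)) 1
  | pop (i : ℕ) (s : ℕ → List Bool) :
      Runs O (.pop i) s (Function.update s i (s i).tail) 1
  | queryYes (i : ℕ) (s : ℕ → List Bool) (h : s i ∈ O) :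
      Runs O (.query i) s (Function.update s i [true]) 1
  | queryNo (i : ℕ) (s : ℕ → List Bool) (h : s i ∉ O) :
      Runs O (.query i) s (Function.update s i [false]) 1
  | seq {p q : Prog} {s s' s'' : ℕ → List Bool} {t t' : ℕ}
      (hp : Runs O p s s' t) (hq : Runs O q s' s'' t') : Runs O (.seq p q) s s'' (t + t')
  | branchEmpty {i : ℕ} {p q r : Prog} {s s' : ℕ → List Bool} {t : ℕ}
      (h : s i = []) (hp : Runs O p s s' t) : Runs O (.branch i p q r) s s' (t + 1)
  | branchFalse {i : ℕ} {p q r : Prog} {s s' : ℕ → List Bool} {t : ℕ} {l : List Bool}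
      (h : s i = false :: l) (hq : Runs O q s s' t) : Runs O (.branch i p q r) s s' (t + 1)
  | branchTrue {i : ℕ} {p q r : Prog} {s s' : ℕ → List Bool} {t : ℕ} {l : List Bool}
      (h : s i = true :: l) (hr : Runs O r s s' t) : Runs O (.branch i p q r) s s' (t + 1)
  | loopDone {i : ℕ} {p : Prog} {s : ℕ → List Bool} (h : s i = []) : Runs O (.loop i p) s s 1
  | loopStep {i : ℕ} {p : Prog} {s s' s'' : ℕ → List Bool} {t t' : ℕ}
      (h : s i ≠ []) (hp : Runs O p s s' t) (hl : Runs O (.loop i p) s' s'' t') :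
      Runs O (.loop i p) s s'' (t + t' + 1)

/-- The function `out`, on instances `i : ι` presented to the machine as the tuple of bit strings
`inp i` (in registers `0, 1, …`, all others being empty), is computed with the oracle `O`, in time
polynomial in the total length of the input. The result is left in register `0`. -/
def PolyTime (O : Set (List Bool)) {ι : Type} (inp : ι → List (List Bool)) (out : ι → List Bool) :
    Prop :=
  ∃ (P : Prog) (p : Polynomial ℕ), ∀ i : ι, ∃ (s : ℕ → List Bool) (t : ℕ),
    Runs O P (fun k => (inp i).getD k []) s t ∧ s 0 = out i ∧
      t ≤ p.eval ((inp i).map List.length).sum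

/-- The class `NP`: membership has certificates of polynomial length that are verified in
polynomial time (without oracle). -/
def InNP (L : Set (List Bool)) : Prop :=
  ∃ V : List Bool → List Bool → Bool,
    PolyTime ∅ (fun xw : List Bool × List Bool => [xw.1, xw.2]) (fun xw => [V xw.1 xw.2]) ∧
    ∃ q : Polynomial ℕ, ∀ x : List Bool,
      x ∈ L ↔ ∃ w : List Bool, w.length ≤ q.eval x.length ∧ V x w = true

/-! ### Concept classes -/

/-- Bit strings of length `k`. -/
abbrev Bits (k : ℕ) : Type := Fin k → Bool

/-- Probability of the event `p` under the uniform distribution on a finite type. -/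
noncomputable def uniformProb {Ω : Type} (p : Ω → Prop) : ℝ :=
  (Nat.card {ω : Ω // p ω} : ℝ) / (Nat.card Ω : ℝ)

/-- A family (indexed by the input length `n`) of sets of concepts `f^α : {0,1}^n → {0,1}`, labeled
by strings `α` of polynomial length `m n`. The strings that label a concept need not be all
strings: they form the nonempty set `labels n`, and `f n α` is only meaningful for those. -/
structure ConceptClass where
  m : ℕ → ℕ
  m_poly : ∃ p : Polynomial ℕ, ∀ n, m n ≤ p.eval n
  labels : (n : ℕ) → Set (Bits (m n))
  labels_nonempty : ∀ n, (labels n).Nonempty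
  f : (n : ℕ) → Bits (m n) → Bits n → Bool

/-- `c`-distinct concept classes. -/
def ConceptClass.IsDistinct (F : ConceptClass) (c : ℝ) : Prop :=
  ∀ n : ℕ, ∀ α₁ ∈ F.labels n, ∀ α₂ ∈ F.labels n, α₁ ≠ α₂ →
    ∃ S : Finset (Bits n), c ≤ (S.card : ℝ) / 2 ^ n ∧ ∀ x ∈ S, F.f n α₁ x ≠ F.f n α₂ x

/-- `E_x |f^α(x) - f^α'(x)|` for uniform `x`, that is, the probability that the concepts differ. -/
noncomputable def ConceptClass.dist (F : ConceptClass) (n : ℕ) (α α' : Bits (F.m n)) : ℝ :=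
  uniformProb (fun x : Bits n => F.f n α x ≠ F.f n α' x)

/-- Datasets, as sequences of labeled inputs. A dataset that is a set is one with `List.Nodup`. -/
abbrev Dataset (n : ℕ) : Type := List (Bits n × Bool)

/-- All points of `T` are labeled by `f^α`. -/
def ConceptClass.Consistent (F : ConceptClass) (n : ℕ) (α : Bits (F.m n)) (T : Dataset n) : Prop :=
  ∀ z ∈ T, z.2 = F.f n α z.1

/-- The dataset of the inputs `X 0, …, X (N - 1)` labeled by `f^α`. -/
def ConceptClass.sample (F : ConceptClass) (n : ℕ) (α : Bits (F.m n)) {N : ℕ}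
    (X : Fin N → Bits n) : Dataset n :=
  List.ofFn (fun i => (X i, F.f n α (X i)))

/-! ### Randomized algorithms on datasets -/

/-- The dataset as the concatenated bit string `x₁ y₁ x₂ y₂ …`. -/
def encodeData {n : ℕ} (T : Dataset n) : List Bool :=
  T.flatMap (fun z => List.ofFn z.1 ++ [z.2])

/-- A positive rational as two numbers in unary, so that time polynomial in `1 / ε` is allowed. -/
def encodeRat (q : ℚ) : List (List Bool) :=
  [List.replicate q.num.toNat true, List.replicate q.den true]

/-- A randomized algorithm that gets a dataset `T`, an error parameter `ε` and a random string `r`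
and outputs a string of length `m n`. Random strings have length `randLen`, a polynomial in the
size of the input; `run` is only meaningful for `r` of that length. -/
structure Learner (F : ConceptClass) where
  ρ : Polynomial ℕ
  run : (n : ℕ) → Dataset n → ℚ → List Bool → Bits (F.m n)

def Learner.randLen {F : ConceptClass} (A : Learner F) (n N : ℕ) (ε : ℚ) : ℕ :=
  A.ρ.eval (n + N + ε.num.toNat + ε.den)

/-- The algorithm runs in polynomial time (without oracle). -/
def Learner.RunsInPolyTime {F : ConceptClass} (A : Learner F) : Prop :=
  PolyTime ∅
    (ι := {i : (Σ n : ℕ, Dataset n) × ℚ × List Bool //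
      0 < i.2.1 ∧ i.2.2.length = A.randLen i.1.1 i.1.2.length i.2.1})
    (fun i => [List.replicate i.1.1.1 true, encodeData i.1.1.2, i.1.2.2] ++ encodeRat i.1.2.1)
    (fun i => List.ofFn (A.run i.1.1.1 i.1.1.2 i.1.2.1 i.1.2.2))

/-- A randomized algorithm with the further input `β` that either outputs a string of length `m n`
or (`none`) the message `invalid dataset`. -/
structure VerifiableLearner (F : ConceptClass) where
  ρ : Polynomial ℕ
  run : ℚ → (n : ℕ) → Dataset n → ℚ → List Bool → Option (Bits (F.m n))

def VerifiableLearner.randLen {F : ConceptClass} (A : VerifiableLearner F)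
    (β : ℚ) (n N : ℕ) (ε : ℚ) : ℕ :=
  A.ρ.eval (n + N + ε.num.toNat + ε.den + β.num.toNat + β.den)

/-- `invalid dataset` is the empty string, a label `α` is written as `1 α`. -/
def encodeOutput {k : ℕ} : Option (Bits k) → List Bool
  | none => []
  | some α => true :: List.ofFn α

/-- The algorithm runs in polynomial time with an oracle for some language in `NP`. -/
def VerifiableLearner.RunsInPolyTimeWithNPOracle {F : ConceptClass} (A : VerifiableLearner F) :
    Prop :=
  ∃ L : Set (List Bool), InNP L ∧
    PolyTime L
      (ι := {i : (Σ n : ℕ, Dataset n) × ℚ × ℚ × List Bool //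
        1 ≤ i.2.1 ∧ 0 < i.2.2.1 ∧
          i.2.2.2.length = A.randLen i.2.1 i.1.1 i.1.2.length i.2.2.1})
      (fun i => [List.replicate i.1.1.1 true, encodeData i.1.1.2, i.1.2.2.2]
        ++ encodeRat i.1.2.2.1 ++ encodeRat i.1.2.1)
      (fun i => encodeOutput (A.run i.1.2.1 i.1.1.1 i.1.1.2 i.1.2.2.1 i.1.2.2.2))

/-! ### The identification tasks, for uniformly distributed inputs -/

/-- The sequence `e` is positive and at most inverse polynomially small. -/
def IsInversePoly (e : ℕ → ℝ) : Prop :=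
  ∃ p : Polynomial ℕ, ∀ n, 0 < e n ∧ 1 / e n ≤ p.eval n

/-- The proper PAC property for the uniform input distribution, with sample size `B n ε δ`: for at
least that many independent uniform inputs labeled by a concept `f^α`, with probability at least
`1 - δ` over the inputs and the random string, the output is the label of a concept that is
`ε`-close to `f^α`. -/
def IsProperPAC (F : ConceptClass) (randLen : ℕ → ℕ → ℚ → ℕ)
    (run : (n : ℕ) → Dataset n → ℚ → List Bool → Option (Bits (F.m n)))
    (B : ℕ → ℚ → ℝ → ℕ) : Prop :=
  ∀ (n : ℕ) (ε : ℚ) (δ : ℝ), 0 < ε → 0 < δ → δ < 1 → ∀ α ∈ F.labels n, ∀ N : ℕ, B n ε δ ≤ N →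
    1 - δ ≤ uniformProb (fun ω : (Fin N → Bits n) × Bits (randLen n N ε) =>
      ∃ α' ∈ F.labels n, run n (F.sample n α ω.1) ε (List.ofFn ω.2) = some α' ∧
        F.dist n α α' ≤ (ε : ℝ))

/-- `A` is an (efficient) approximate-correct identification algorithm for datasets of size at
least `B n ε δ`. -/
structure IsApproxCorrect (F : ConceptClass) (A : Learner F) (B : ℕ → ℚ → ℝ → ℕ) : Prop where
  size_poly : ∃ p : Polynomial ℕ, ∀ (n : ℕ) (ε : ℚ) (δ : ℝ), 0 < ε → 0 < δ → δ < 1 →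
    B n ε δ ≤ p.eval (n + ⌈1 / ε⌉₊ + ⌈1 / δ⌉₊)
  time_poly : A.RunsInPolyTime
  proper : ∀ (n : ℕ) (ε : ℚ) (δ : ℝ), 0 < ε → 0 < δ → δ < 1 →
    ∀ T : Dataset n, B n ε δ ≤ T.length →
    ∀ r : List Bool, r.length = A.randLen n T.length ε → A.run n T ε r ∈ F.labels n
  pac : IsProperPAC F A.randLen (fun n T ε r => some (A.run n T ε r)) B
  /-- A concept that mislabels all points of the dataset is never output. -/
  never_totally_incorrect : ∃ ε₁ : ℕ → ℝ, IsInversePoly ε₁ ∧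
    ∀ (n : ℕ) (ε : ℚ) (δ : ℝ), 0 < ε → (ε : ℝ) ≤ ε₁ n → 0 < δ → δ < 1 →
    ∀ T : Dataset n, T.Nodup → B n ε δ ≤ T.length →
    ∀ α ∈ F.labels n, (∀ z ∈ T, z.2 ≠ F.f n α z.1) →
    ∀ r : List Bool, r.length = A.randLen n T.length ε → A.run n T ε r ≠ α
  /-- On consistent data, some random string leads to a concept at distance at most `1/3`. -/
  sometimes_close : ∃ ε₂ : ℕ → ℝ, IsInversePoly ε₂ ∧
    ∀ (n : ℕ) (ε : ℚ) (δ : ℝ), 0 < ε → (ε : ℝ) ≤ ε₂ n → 0 < δ → δ < 1 →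
    ∀ T : Dataset n, (T.map Prod.fst).Nodup → B n ε δ ≤ T.length →
    ∀ α ∈ F.labels n, F.Consistent n α T →
    ∃ r : List Bool, r.length = A.randLen n T.length ε ∧ F.dist n α (A.run n T ε r) ≤ 1 / 3

/-- `A` is an approximate-verifiable identification algorithm for datasets of size at least
`B β n ε δ`, running in polynomial time with an `NP` oracle. -/
structure IsApproxVerifiable (F : ConceptClass) (A : VerifiableLearner F)
    (B : ℚ → ℕ → ℚ → ℝ → ℕ) : Prop where
  size_poly : ∃ p : Polynomial ℕ, ∀ (β : ℚ) (n : ℕ) (ε : ℚ) (δ : ℝ),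
    1 ≤ β → 0 < ε → 0 < δ → δ < 1 →
    B β n ε δ ≤ p.eval (n + ⌈1 / ε⌉₊ + ⌈1 / δ⌉₊ + ⌈β⌉₊)
  time_poly : A.RunsInPolyTimeWithNPOracle
  pac : ∀ β : ℚ, 1 ≤ β → IsProperPAC F (A.randLen β) (A.run β) (B β)
  /-- Whatever is output is a concept that labels correctly all but a fraction `1/β` of the points.
  (So the output is `none` if there is no such concept.) -/
  soundness : ∀ (β : ℚ) (n : ℕ) (ε : ℚ) (δ : ℝ), 1 ≤ β → 0 < ε → 0 < δ → δ < 1 →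
    ∀ T : Dataset n, T.Nodup → B β n ε δ ≤ T.length →
    ∀ r : List Bool, r.length = A.randLen β n T.length ε →
    ∀ α : Bits (F.m n), A.run β n T ε r = some α →
      α ∈ F.labels n ∧ ∃ T' : Dataset n, T'.Sublist T ∧
        (1 - 1 / (β : ℝ)) * (T.length : ℝ) ≤ (T'.length : ℝ) ∧ F.Consistent n α T'
  completeness : ∀ (β : ℚ) (n : ℕ) (ε : ℚ) (δ : ℝ), 1 ≤ β → 1 / 3 ≤ ε → 0 < δ → δ < 1 →
    ∀ T : Dataset n, T.Nodup → B β n ε δ ≤ T.length →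
    ∀ α ∈ F.labels n, F.Consistent n α T →
    ∃ r : List Bool, r.length = A.randLen β n T.length ε ∧ A.run β n T ε r = some α

/-! Let `A` be the given algorithm. The new learner lowers the error parameter to at most `1 /
Q(n)`, runs `A` to obtain a candidate `α`, and asks one NP question: is there a set of at least `|T|
/ β` points of `T` such that `A`, run on these points with all labels flipped, outputs `α` for some
random string? It rejects if so and otherwise outputs `α`. Flipping exchanges the two properties of
`A`.

If `α` is consistent with `T`, it mislabels every point of a flipped subset, so `A` never outputs it
there and the answer is no (`question_not_mem_oracle`). If `α` is wrong on at least `|T| / β`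
points, it is consistent with exactly these points flipped, so some random string makes `A` output a
concept within `1/3` of `α`, and the answer is yes (`exists_sublist_of_not_mem_oracle`). Distance at
most `1/3` means equality in a `c`-distinct class with `c ≥ 1/3` (`eq_of_dist_le`). The factor `β`
in the sample size makes every admissible subset large enough for `A` (`le_length_of_large`).

The PAC property passes to the new learner: since the lowered error is at most `1/3`, a successful
run of `A` finds the target itself, which is never rejected.

What remains is complexity on the concrete machine. A certificate consists of a mask selecting the
subset, the random string, and Bézout coefficients showing that the error parameter is in lowest
terms (`exists_of_mem_oracle`, `mem_oracle`). Programs are built by a calculus of contexts: `Comp O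
Γ f` says that `f` can be computed in polynomial time from the strings in `Γ`, and `Comp.whileLoop`
is its only loop rule. All queries in the language start with `true`, so `A`, which expects the
empty oracle, can be simulated next to the new oracle (`polyTime_of_guarded`). -/

namespace StackMachine

/-! ### Polynomial bounds -/

/-- `f` is bounded by a polynomial in `g`. -/
def PolyLe {ι : Type} (f g : ι → ℕ) : Prop :=
  ∃ p : Polynomial ℕ, ∀ i, f i ≤ p.eval (g i)

theorem eval_mono (p : Polynomial ℕ) {a b : ℕ} (h : a ≤ b) : p.eval a ≤ p.eval b := by
  simp only [Polynomial.eval_eq_sum_range]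
  gcongr

namespace PolyLe

variable {ι κ : Type} {f g h : ι → ℕ}

theorem of_le (hfg : ∀ i, f i ≤ g i) : PolyLe f g :=
  ⟨Polynomial.X, fun i => by simpa using hfg i⟩

theorem const (c : ℕ) : PolyLe (fun _ => c) g :=
  ⟨Polynomial.C c, fun i => by simp⟩

theorem add (hf : PolyLe f h) (hg : PolyLe g h) : PolyLe (fun i => f i + g i) h := by
  obtain ⟨p, hp⟩ := hf
  obtain ⟨q, hq⟩ := hg
  exact ⟨p + q, fun i => by simpa using add_le_add (hp i) (hq i)⟩

theorem mul (hf : PolyLe f h) (hg : PolyLe g h) : PolyLe (fun i => f i * g i) h := by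
  obtain ⟨p, hp⟩ := hf
  obtain ⟨q, hq⟩ := hg
  exact ⟨p * q, fun i => by simpa using Nat.mul_le_mul (hp i) (hq i)⟩

theorem trans (hfg : PolyLe f g) (hgh : PolyLe g h) : PolyLe f h := by
  obtain ⟨p, hp⟩ := hfg
  obtain ⟨q, hq⟩ := hgh
  exact ⟨p.comp q, fun i => by
    rw [Polynomial.eval_comp]
    exact (hp i).trans (eval_mono p (hq i))⟩

theorem mono (hle : ∀ i, f i ≤ g i) (hg : PolyLe g h) : PolyLe f h :=
  (of_le hle).trans hg

theorem reindex (φ : κ → ι) (hfg : PolyLe f g) : PolyLe (fun k => f (φ k)) (fun k => g (φ k)) := by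
  obtain ⟨p, hp⟩ := hfg
  exact ⟨p, fun k => hp (φ k)⟩

end PolyLe

/-! ### States -/

/-- The state with the registers `0, 1, …` given by a list, all others being empty. -/
def st (l : List (List Bool)) : ℕ → List Bool := fun k => l.getD k []

/-- The total length of a tuple of strings. -/
def size (l : List (List Bool)) : ℕ := (l.map List.length).sum

/-- A context is a list of strings depending on an index `i`; `ev Γ i` is its value at `i`. -/
def ev {ι : Type} (Γ : List (ι → List Bool)) (i : ι) : List (List Bool) := Γ.map (fun f => f i)

section Basic

variable {ι : Type}

@[simp] theorem ev_nil (i : ι) : ev [] i = [] := rfl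

@[simp] theorem ev_cons (f : ι → List Bool) (Γ : List (ι → List Bool)) (i : ι) :
    ev (f :: Γ) i = f i :: ev Γ i := rfl

@[simp] theorem ev_append (Γ Δ : List (ι → List Bool)) (i : ι) :
    ev (Γ ++ Δ) i = ev Γ i ++ ev Δ i := by simp [ev]

@[simp] theorem length_ev (Γ : List (ι → List Bool)) (i : ι) : (ev Γ i).length = Γ.length := by
  simp [ev]

@[simp] theorem size_nil : size [] = 0 := rfl

@[simp] theorem size_cons (a : List Bool) (l : List (List Bool)) :
    size (a :: l) = a.length + size l := by simp [size]

@[simp] theorem size_append (l l' : List (List Bool)) : size (l ++ l') = size l + size l' := by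
  simp [size]

theorem length_le_size {a : List Bool} {l : List (List Bool)} (h : a ∈ l) : a.length ≤ size l :=
  List.le_sum_of_mem (List.mem_map_of_mem h)

theorem length_le_size_ev {f : ι → List Bool} {Γ : List (ι → List Bool)} (h : f ∈ Γ) (i : ι) :
    (f i).length ≤ size (ev Γ i) :=
  length_le_size (List.mem_map.2 ⟨f, h, rfl⟩)

theorem st_append (l l' : List (List Bool)) (k : ℕ) :
    st (l ++ l') k = if k < l.length then st l k else st l' (k - l.length) := by
  unfold st
  split_ifs with h
  · exact List.getD_append _ _ _ _ h
  · exact List.getD_append_right _ _ _ _ (by omega)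

theorem st_of_le (l : List (List Bool)) (k : ℕ) (h : l.length ≤ k) : st l k = [] := by
  simp [st, List.getD, List.getElem?_eq_none h]

theorem sum_st (l : List (List Bool)) (K : ℕ) (h : l.length ≤ K) :
    ∑ k ∈ Finset.range K, (st l k).length = size l := by
  induction l generalizing K with
  | nil => simp [st]
  | cons a l ih =>
    obtain ⟨K, rfl⟩ : ∃ K', K = K' + 1 := ⟨K - 1, by simp at h; omega⟩
    rw [Finset.sum_range_succ']
    have := ih K (by simpa using h)
    simp only [st, List.getD_cons_succ, List.getD_cons_zero, size_cons] at this ⊢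
    omega

end Basic

/-- Each elementary step adds at most one bit in total; a query leaves a single bit, so it also
respects this. Hence running time bounds output size, which is what lets polynomial bounds compose.
-/
theorem sum_length_runs {O : Set (List Bool)} {P : Prog} {s s' : ℕ → List Bool} {t : ℕ}
    (h : Runs O P s s' t) (K : ℕ) :
    ∑ k ∈ Finset.range K, (s' k).length ≤ ∑ k ∈ Finset.range K, (s k).length + t := by
  have upd : ∀ (s : ℕ → List Bool) (i : ℕ) (l : List Bool), l.length ≤ (s i).length + 1 →
      ∑ k ∈ Finset.range K, (Function.update s i l k).length
        ≤ ∑ k ∈ Finset.range K, (s k).length + 1 := by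
    intro s i l hl
    by_cases hi : i ∈ Finset.range K
    · rw [← Finset.add_sum_erase _ _ hi, ← Finset.add_sum_erase _ (fun k => (s k).length) hi]
      have : ∑ k ∈ (Finset.range K).erase i, (Function.update s i l k).length
          = ∑ k ∈ (Finset.range K).erase i, (s k).length :=
        Finset.sum_congr rfl fun k hk => by
          rw [Function.update_of_ne (Finset.ne_of_mem_erase hk)]
      rw [this, Function.update_self]
      omega
    · refine le_trans (le_of_eq ?_) (Nat.le_succ _)
      refine Finset.sum_congr rfl fun k hk => ?_
      rw [Function.update_of_ne]
      rintro rfl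
      exact hi hk
  induction h with
  | skip => omega
  | push i b s => exact upd _ _ _ (by simp)
  | pop i s => exact upd _ _ _ (by simp; omega)
  | queryYes i s h => exact upd _ _ _ (by simp)
  | queryNo i s h => exact upd _ _ _ (by simp)
  | loopDone => omega
  | seq _ _ h1 h2 => omega
  | branchEmpty _ _ h => omega
  | branchFalse _ _ h => omega
  | branchTrue _ _ h => omega
  | loopStep _ _ _ h1 h2 => omega

theorem size_runs {O : Set (List Bool)} {P : Prog} {l l' : List (List Bool)} {t : ℕ}
    (h : Runs O P (st l) (st l') t) : size l' ≤ size l + t := by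
  have := sum_length_runs h (max l.length l'.length)
  rwa [sum_st _ _ (le_max_left _ _), sum_st _ _ (le_max_right _ _)] at this

/-! ### Relocation of programs -/

/-- The program that uses register `k + i` instead of register `i`. -/
def shift (k : ℕ) : Prog → Prog
  | .skip => .skip
  | .push i b => .push (k + i) b
  | .pop i => .pop (k + i)
  | .query i => .query (k + i)
  | .seq p q => .seq (shift k p) (shift k q)
  | .branch i p q r => .branch (k + i) (shift k p) (shift k q) (shift k r)
  | .loop i p => .loop (k + i) (shift k p)

/-- The state `u` below `k`, followed by the state `s`. -/
def glue (k : ℕ) (u s : ℕ → List Bool) : ℕ → List Bool :=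
  fun j => if j < k then u j else s (j - k)

@[simp] theorem glue_add (k : ℕ) (u s : ℕ → List Bool) (i : ℕ) : glue k u s (k + i) = s i := by
  simp [glue]

theorem glue_update (k : ℕ) (u s : ℕ → List Bool) (i : ℕ) (l : List Bool) :
    glue k u (Function.update s i l) = Function.update (glue k u s) (k + i) l := by
  funext j
  by_cases hj : j = k + i
  · subst hj
    simp
  · rw [Function.update_of_ne hj]
    unfold glue
    split_ifs with h
    · rfl
    · rw [Function.update_of_ne (by omega)]

/-- A relocated program cannot see the registers below `k`, so any program can run as a subroutine
behind live data. -/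
theorem runs_shift {O : Set (List Bool)} {P : Prog} {s s' : ℕ → List Bool} {t : ℕ}
    (h : Runs O P s s' t) (k : ℕ) (u : ℕ → List Bool) :
    Runs O (shift k P) (glue k u s) (glue k u s') t := by
  induction h with
  | skip s => exact .skip _
  | push i b s => simpa [glue_update, shift] using Runs.push (O := O) (k + i) b (glue k u s)
  | pop i s => simpa [glue_update, shift] using Runs.pop (O := O) (k + i) (glue k u s)
  | queryYes i s h =>
    simpa [glue_update, shift] using Runs.queryYes (O := O) (k + i) (glue k u s) (by simpa using h)
  | queryNo i s h =>
    simpa [glue_update, shift] using Runs.queryNo (O := O) (k + i) (glue k u s) (by simpa using h)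
  | seq _ _ h1 h2 => exact .seq h1 h2
  | branchEmpty h _ ih => exact .branchEmpty (by simpa using h) ih
  | branchFalse h _ ih => exact .branchFalse (by simpa using h) ih
  | branchTrue h _ ih => exact .branchTrue (by simpa using h) ih
  | loopDone h => exact .loopDone (by simpa using h)
  | loopStep h _ _ h1 h2 => exact .loopStep (by simpa using h) h1 h2

theorem glue_st (l l' : List (List Bool)) : glue l.length (st l) (st l') = st (l ++ l') := by
  funext j
  rw [st_append]
  rfl

/-- A bound for the registers used by a program. -/
def regBound : Prog → ℕ
  | .skip => 0
  | .push i _ => i + 1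
  | .pop i => i + 1
  | .query i => i + 1
  | .seq p q => max (regBound p) (regBound q)
  | .branch i p q r => max (i + 1) (max (regBound p) (max (regBound q) (regBound r)))
  | .loop i p => max (i + 1) (regBound p)

/-- Needed for programs given only by `PolyTime`, which may leave arbitrary junk: it confines the
junk to finitely many registers. -/
theorem runs_unchanged {O : Set (List Bool)} {P : Prog} {s s' : ℕ → List Bool} {t : ℕ}
    (h : Runs O P s s' t) {j : ℕ} (hj : regBound P ≤ j) : s' j = s j := by
  induction h with
  | skip s => rfl
  | push i b s => exact Function.update_of_ne (by simp [regBound] at hj; omega) _ _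
  | pop i s => exact Function.update_of_ne (by simp [regBound] at hj; omega) _ _
  | queryYes i s h => exact Function.update_of_ne (by simp [regBound] at hj; omega) _ _
  | queryNo i s h => exact Function.update_of_ne (by simp [regBound] at hj; omega) _ _
  | seq _ _ h1 h2 =>
    simp only [regBound, max_le_iff] at hj
    rw [h2 hj.2, h1 hj.1]
  | branchEmpty h _ ih =>
    simp only [regBound, max_le_iff] at hj
    exact ih hj.2.1
  | branchFalse h _ ih =>
    simp only [regBound, max_le_iff] at hj
    exact ih hj.2.2.1
  | branchTrue h _ ih =>
    simp only [regBound, max_le_iff] at hj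
    exact ih hj.2.2.2
  | loopDone h => rfl
  | loopStep h _ _ h1 h2 =>
    rw [h2 hj]
    simp only [regBound, max_le_iff] at hj
    exact h1 hj.2

/-- Replace all oracle queries by queries about strings that start with `false`. -/
def guardQueries : Prog → Prog
  | .skip => .skip
  | .push i b => .push i b
  | .pop i => .pop i
  | .query i => .seq (.push i false) (.query i)
  | .seq p q => .seq (guardQueries p) (guardQueries q)
  | .branch i p q r => .branch i (guardQueries p) (guardQueries q) (guardQueries r)
  | .loop i p => .loop i (guardQueries p)

/-- The empty oracle always answers no, and so does `O` once `false` is pushed onto the query. The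
answer overwrites the register, so the pushed bit leaves no trace; a query now costs two steps,
whence the factor 2. -/
theorem runs_guardQueries {O : Set (List Bool)} (hO : ∀ l, false :: l ∉ O) {P : Prog}
    {s s' : ℕ → List Bool} {t : ℕ} (h : Runs ∅ P s s' t) :
    ∃ t' ≤ 2 * t, Runs O (guardQueries P) s s' t' := by
  induction h with
  | skip s => exact ⟨1, by omega, .skip _⟩
  | push i b s => exact ⟨1, by omega, .push _ _ _⟩
  | pop i s => exact ⟨1, by omega, .pop _ _⟩
  | queryYes i s h => exact h.elim
  | queryNo i s h =>
    refine ⟨1 + 1, by omega, ?_⟩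
    have := Runs.queryNo (O := O) i (Function.update s i (false :: s i)) (by simpa using hO _)
    rw [Function.update_idem] at this
    exact .seq (.push _ _ _) this
  | seq _ _ h1 h2 =>
    obtain ⟨t1, b1, r1⟩ := h1
    obtain ⟨t2, b2, r2⟩ := h2
    exact ⟨_, by omega, .seq r1 r2⟩
  | branchEmpty h _ ih =>
    obtain ⟨t1, b1, r1⟩ := ih
    exact ⟨_, by omega, .branchEmpty h r1⟩
  | branchFalse h _ ih =>
    obtain ⟨t1, b1, r1⟩ := ih
    exact ⟨_, by omega, .branchFalse h r1⟩
  | branchTrue h _ ih =>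
    obtain ⟨t1, b1, r1⟩ := ih
    exact ⟨_, by omega, .branchTrue h r1⟩
  | loopDone h => exact ⟨1, by omega, .loopDone h⟩
  | loopStep h _ _ h1 h2 =>
    obtain ⟨t1, b1, r1⟩ := h1
    obtain ⟨t2, b2, r2⟩ := h2
    exact ⟨_, by omega, .loopStep h r1 r2⟩

theorem polyTime_of_guarded {O : Set (List Bool)} (hO : ∀ l, false :: l ∉ O) {ι : Type}
    {inp : ι → List (List Bool)} {out : ι → List Bool} (h : PolyTime ∅ inp out) :
    PolyTime O inp out := by
  obtain ⟨P, p, hP⟩ := h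
  refine ⟨guardQueries P, 2 * p, fun i => ?_⟩
  obtain ⟨s, t, hr, h0, ht⟩ := hP i
  obtain ⟨t', ht', hr'⟩ := runs_guardQueries hO hr
  refine ⟨s, t', hr', h0, ht'.trans ?_⟩
  simpa using ht

/-! ### Elementary programs -/

theorem runs_congr {O : Set (List Bool)} {P : Prog} {s s' s'' : ℕ → List Bool} {t t' : ℕ}
    (h : Runs O P s s' t) (e : s' = s'') (et : t = t') : Runs O P s s'' t' := e ▸ et ▸ h

/-- Empty the register `i`. -/
def clearReg (i : ℕ) : Prog := .loop i (.pop i)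

theorem runs_clearReg (O : Set (List Bool)) (i : ℕ) (s : ℕ → List Bool) :
    Runs O (clearReg i) s (Function.update s i []) (2 * (s i).length + 1) := by
  induction h : s i generalizing s with
  | nil =>
    exact runs_congr (Runs.loopDone h) (by rw [← h, Function.update_eq_self]) rfl
  | cons b l ih =>
    have h1 := Runs.loopStep (by simp [h]) (Runs.pop (O := O) i s) (ih _ (by simp [h]))
    rw [Function.update_idem] at h1
    exact runs_congr h1 rfl (by simp [List.length_cons]; omega)

/-- Move the content of register `i`, reversed, on top of register `k`. -/
def moveRev (i k : ℕ) : Prog :=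
  .loop i (.branch i .skip (.seq (.pop i) (.push k false)) (.seq (.pop i) (.push k true)))

theorem runs_moveRev (O : Set (List Bool)) {i k : ℕ} (hik : i ≠ k) (s : ℕ → List Bool) :
    Runs O (moveRev i k) s
      (Function.update (Function.update s i []) k ((s i).reverse ++ s k))
      (4 * (s i).length + 1) := by
  induction h : s i generalizing s with
  | nil =>
    have : Function.update (Function.update s i []) k (([] : List Bool).reverse ++ s k) = s := by
      rw [← h, Function.update_eq_self]
      simp [h]
    rw [this]
    exact Runs.loopDone h
  | cons b l ih =>
    have body : Runs O (.branch i .skip (.seq (.pop i) (.push k false))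
        (.seq (.pop i) (.push k true))) s
        (Function.update (Function.update s i l) k (b :: s k)) 3 := by
      have h1 := Runs.seq (Runs.pop (O := O) i s) (Runs.push (O := O) k b _)
      rw [Function.update_of_ne hik.symm, h, List.tail_cons] at h1
      cases b
      · exact .branchFalse h h1
      · exact .branchTrue h h1
    have h1 := Runs.loopStep (by simp [h]) body (ih _ (by
      rw [Function.update_of_ne hik, Function.update_self]))
    refine runs_congr h1 (s'' := Function.update (Function.update s i []) k
        ((b :: l).reverse ++ s k)) (by
      funext x
      by_cases hk : x = k
      · subst hk
        simp
      · by_cases hi : x = i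
        · subst hi
          simp [hk]
        · simp [hk, hi]) (by simp [List.length_cons]; omega)

/-- Move the content of register `t`, reversed, on top of both registers `j` and `k`. -/
def moveRevTwo (t j k : ℕ) : Prog :=
  .loop t (.branch t .skip (.seq (.pop t) (.seq (.push j false) (.push k false)))
    (.seq (.pop t) (.seq (.push j true) (.push k true))))

theorem runs_moveRevTwo (O : Set (List Bool)) {t j k : ℕ} (htj : t ≠ j) (htk : t ≠ k)
    (hjk : j ≠ k) (s : ℕ → List Bool) :
    Runs O (moveRevTwo t j k) s
      (Function.update (Function.update (Function.update s t []) j ((s t).reverse ++ s j))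
        k ((s t).reverse ++ s k)) (5 * (s t).length + 1) := by
  induction h : s t generalizing s with
  | nil =>
    have : Function.update (Function.update (Function.update s t []) j
        (([] : List Bool).reverse ++ s j)) k (([] : List Bool).reverse ++ s k) = s := by
      rw [← h, Function.update_eq_self]
      simp [h]
    rw [this]
    exact Runs.loopDone h
  | cons b l ih =>
    have body : Runs O (.branch t .skip (.seq (.pop t) (.seq (.push j false) (.push k false)))
        (.seq (.pop t) (.seq (.push j true) (.push k true)))) s
        (Function.update (Function.update (Function.update s t l) j (b :: s j)) k (b :: s k)) 4 := by
      have h1 := Runs.seq (Runs.pop (O := O) t s)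
        (Runs.seq (Runs.push (O := O) j b _) (Runs.push (O := O) k b _))
      rw [Function.update_of_ne htj.symm, Function.update_of_ne hjk.symm,
        Function.update_of_ne htk.symm, h, List.tail_cons] at h1
      cases b
      · exact .branchFalse h h1
      · exact .branchTrue h h1
    have h1 := Runs.loopStep (by simp [h]) body (ih _ (by
      rw [Function.update_of_ne htk, Function.update_of_ne htj, Function.update_self]))
    refine runs_congr h1 (s'' := Function.update (Function.update (Function.update s t []) j
        ((b :: l).reverse ++ s j)) k ((b :: l).reverse ++ s k)) (by
      funext x
      by_cases hk : x = k
      · subst hk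
        simp
      · by_cases hj : x = j
        · subst hj
          simp [hk]
        · by_cases ht : x = t
          · subst ht
            simp [hk, hj]
          · simp [hk, hj, ht]) (by simp [List.length_cons]; omega)

end StackMachine

namespace StackMachine

/-! ### Computations in contexts -/

/-- An empty last register is the same as no register, so clearing the last register removes it from
the context. -/
theorem st_append_nil (l : List (List Bool)) : st (l ++ [[]]) = st l := by
  funext k
  rw [st_append]
  split_ifs with h
  · rfl
  · rw [st_of_le l k (by omega)]
    cases k - l.length <;> simp [st]

theorem st_length (l : List (List Bool)) (a : List Bool) (m : List (List Bool)) :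
    st (l ++ a :: m) l.length = a := by
  simp [st]

theorem update_st (l : List (List Bool)) (a b : List Bool) (m : List (List Bool)) :
    Function.update (st (l ++ a :: m)) l.length b = st (l ++ b :: m) := by
  funext k
  by_cases h : k = l.length
  · subst h
    rw [Function.update_self, st_length]
  · rw [Function.update_of_ne h, st_append, st_append]
    split_ifs with h'
    · rfl
    · obtain ⟨j, hj⟩ : ∃ j, k - l.length = j + 1 := ⟨k - l.length - 1, by omega⟩
      rw [hj]
      rfl

theorem update_st_end (l : List (List Bool)) (b : List Bool) :
    Function.update (st l) l.length b = st (l ++ [b]) := by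
  rw [← st_append_nil l, update_st]

variable {O : Set (List Bool)} {ι κ : Type}

/-- Some program transforms the context `Γ` into the context `Δ` in polynomial time. -/
def Trans (O : Set (List Bool)) {ι : Type} (Γ Δ : List (ι → List Bool)) : Prop :=
  ∃ (P : Prog) (t : ι → ℕ), (∀ i, Runs O P (st (ev Γ i)) (st (ev Δ i)) (t i)) ∧
    PolyLe t (fun i => size (ev Γ i))

/-- In the context `Γ`, some program appends the string `f` in polynomial time. -/
def Comp (O : Set (List Bool)) {ι : Type} (Γ : List (ι → List Bool)) (f : ι → List Bool) : Prop :=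
  Trans O Γ (Γ ++ [f])

/-- Change of the index type. -/
def pull (φ : κ → ι) (Γ : List (ι → List Bool)) : List (κ → List Bool) :=
  Γ.map (fun f k => f (φ k))

@[simp] theorem pull_nil (φ : κ → ι) : pull φ [] = [] := rfl

@[simp] theorem pull_cons (φ : κ → ι) (f : ι → List Bool) (Γ : List (ι → List Bool)) :
    pull φ (f :: Γ) = (fun k => f (φ k)) :: pull φ Γ := rfl

@[simp] theorem pull_append (φ : κ → ι) (Γ Δ : List (ι → List Bool)) :
    pull φ (Γ ++ Δ) = pull φ Γ ++ pull φ Δ := by simp [pull]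

@[simp] theorem ev_pull (φ : κ → ι) (Γ : List (ι → List Bool)) (k : κ) :
    ev (pull φ Γ) k = ev Γ (φ k) := by simp [ev, pull]

@[simp] theorem length_pull (φ : κ → ι) (Γ : List (ι → List Bool)) :
    (pull φ Γ).length = Γ.length := by simp [pull]

theorem mem_pull {φ : κ → ι} {f : ι → List Bool} {Γ : List (ι → List Bool)} (h : f ∈ Γ) :
    (fun k => f (φ k)) ∈ pull φ Γ := List.mem_map.2 ⟨f, h, rfl⟩

/-! ### Structural rules for contexts: framing, copying, deleting -/

namespace Trans

variable {Γ Δ E : List (ι → List Bool)}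

theorem of_bound (P : Prog) (b : ι → ℕ)
    (h : ∀ i, ∃ t ≤ b i, Runs O P (st (ev Γ i)) (st (ev Δ i)) t)
    (hb : PolyLe b (fun i => size (ev Γ i))) : Trans O Γ Δ := by
  choose t ht hr using h
  exact ⟨P, t, hr, hb.mono ht⟩

theorem exists_poly (h : Trans O Γ Δ) : ∃ (P : Prog) (p : Polynomial ℕ), ∀ i,
    ∃ t ≤ p.eval (size (ev Γ i)), Runs O P (st (ev Γ i)) (st (ev Δ i)) t := by
  obtain ⟨P, t, hr, p, hp⟩ := h
  exact ⟨P, p, fun i => ⟨t i, hp i, hr i⟩⟩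

theorem refl (O : Set (List Bool)) (Γ : List (ι → List Bool)) : Trans O Γ Γ :=
  ⟨.skip, fun _ => 1, fun _ => .skip _, .const 1⟩

theorem size_le (h : Trans O Γ Δ) :
    PolyLe (fun i => size (ev Δ i)) (fun i => size (ev Γ i)) := by
  obtain ⟨P, t, hr, ht⟩ := h
  exact ((PolyLe.of_le fun i => le_rfl).add ht).mono fun i => size_runs (hr i)

theorem trans (h : Trans O Γ Δ) (h' : Trans O Δ E) : Trans O Γ E := by
  have hs := h.size_le
  obtain ⟨P, t, hr, ht⟩ := h
  obtain ⟨P', t', hr', ht'⟩ := h'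
  exact ⟨.seq P P', fun i => t i + t' i, fun i => .seq (hr i) (hr' i), ht.add (ht'.trans hs)⟩

theorem reindex (h : Trans O Γ Δ) (φ : κ → ι) : Trans O (pull φ Γ) (pull φ Δ) := by
  obtain ⟨P, t, hr, ht⟩ := h
  refine ⟨P, fun k => t (φ k), fun k => ?_, ?_⟩
  · simpa using hr (φ k)
  · simpa using ht.reindex φ

theorem frame (E : List (ι → List Bool)) (h : Trans O Γ Δ) : Trans O (E ++ Γ) (E ++ Δ) := by
  obtain ⟨P, t, hr, ht⟩ := h
  refine ⟨shift E.length P, t, fun i => ?_, ht.trans (.of_le fun i => by simp)⟩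
  have := runs_shift (hr i) E.length (st (ev E i))
  rw [← length_ev E i, glue_st, glue_st] at this
  simpa using this

theorem copy {f : ι → List Bool} (h : f ∈ Γ) : Trans O Γ (Γ ++ [f]) := by
  obtain ⟨A, B, rfl⟩ := List.append_of_mem h
  set k := (A ++ f :: B).length with hk
  have hA : A.length < k := by simp [hk]
  -- Moving a stack reverses it. The content goes to the scratch register `k + 1` and from there,
  -- reversed again, both back to its place and to the new register `k`.
  refine of_bound (.seq (moveRev A.length (k + 1)) (moveRevTwo (k + 1) A.length k))
    (fun i => (4 * (f i).length + 1) + (5 * (f i).length + 1)) (fun i => ⟨_, le_rfl, ?_⟩) ?_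
  · have e1 : st (ev (A ++ f :: B) i) A.length = f i := by
      simpa using st_length (ev A i) (f i) (ev B i)
    have e2 : ∀ j, k ≤ j → st (ev (A ++ f :: B) i) j = [] := fun j hj =>
      st_of_le _ _ (by rw [length_ev]; exact hj)
    have h1 := runs_moveRev O (show A.length ≠ k + 1 by omega) (st (ev (A ++ f :: B) i))
    rw [e1, e2 (k + 1) (by omega)] at h1
    refine Runs.seq h1 (runs_congr (runs_moveRevTwo O (by omega) (by omega) (by omega) _) ?_ ?_)
    · have e3 : st (ev (A ++ f :: B ++ [f]) i) = Function.update (st (ev (A ++ f :: B) i)) k (f i) := by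
        rw [hk, ← length_ev _ i, update_st_end]
        simp
      rw [e3]
      generalize st (ev (A ++ f :: B) i) = u at *
      funext x
      by_cases h1 : x = k
      · subst h1
        simp [hA.ne', e2]
      · by_cases h2 : x = A.length
        · subst h2
          simp [hA.ne, e1, show A.length ≠ k + 1 by omega]
        · by_cases h3 : x = k + 1
          · subst h3
            simp [h2, e2]
          · simp [h1, h2, h3]
    · simp
  · have : PolyLe (fun i => (f i).length) (fun i => size (ev (A ++ f :: B) i)) :=
      .of_le fun i => length_le_size_ev h i
    exact (((PolyLe.const 4).mul this).add (.const 1)).add (((PolyLe.const 5).mul this).add (.const 1))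

/-- Discards `f` and moves `g` into its place through the first free register `T`, two moves
restoring the order of the bits. Iterated in `dropOne`, it carries the hole to the end of the
context. -/
theorem swapClear (f g : ι → List Bool) :
    Trans O (Γ ++ f :: g :: E) (Γ ++ g :: (fun _ => []) :: E) := by
  set k := Γ.length with hk
  set T := (Γ ++ f :: g :: E).length with hT
  have hkT : k + 1 < T := by simp [hT, hk]
  refine of_bound (.seq (clearReg k) (.seq (moveRev (k + 1) T) (moveRev T k)))
    (fun i => (2 * (f i).length + 1) + ((4 * (g i).length + 1) + (4 * (g i).length + 1)))
    (fun i => ⟨_, le_rfl, ?_⟩) ?_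
  · have hl : (ev Γ i).length = k := by simp [hk]
    have h1 := runs_clearReg O k (st (ev (Γ ++ f :: g :: E) i))
    rw [ev_append, ev_cons, ev_cons, ← hl, update_st, st_length, hl] at h1
    have e1 : st (ev Γ i ++ [] :: g i :: ev E i) (k + 1) = g i := by
      have := st_length (ev Γ i ++ [[]]) (g i) (ev E i)
      simpa [hl] using this
    have e2 : st (ev Γ i ++ [] :: g i :: ev E i) T = [] := st_of_le _ _ (by simp [hT])
    have h2 := runs_moveRev O (show k + 1 ≠ T by omega) (st (ev Γ i ++ [] :: g i :: ev E i))
    rw [e1, e2] at h2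
    have e3 : Function.update (st (ev Γ i ++ [] :: g i :: ev E i)) (k + 1) []
        = st (ev Γ i ++ [] :: [] :: ev E i) := by
      have := update_st (ev Γ i ++ [[]]) (g i) [] (ev E i)
      simpa [hl] using this
    rw [e3] at h2
    have h3 := runs_moveRev O (show T ≠ k by omega)
      (Function.update (st (ev Γ i ++ [] :: [] :: ev E i)) T ((g i).reverse ++ []))
    rw [Function.update_self, Function.update_idem, Function.update_of_ne (by omega)] at h3
    have e4 : Function.update (st (ev Γ i ++ [] :: [] :: ev E i)) T []
        = st (ev Γ i ++ [] :: [] :: ev E i) := by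
      rw [Function.update_eq_self_iff]
      exact (st_of_le _ _ (by simp [hT])).symm
    have e5 : st (ev Γ i ++ [] :: [] :: ev E i) k = [] := by rw [← hl, st_length]
    rw [e4, e5, ← hl, update_st, hl] at h3
    refine (Runs.seq ?_ (Runs.seq h2 (runs_congr h3 ?_ ?_)))
    · simpa using h1
    · simp
    · simp
  · have h1 : PolyLe (fun i => (f i).length) (fun i => size (ev (Γ ++ f :: g :: E) i)) :=
      .of_le fun i => length_le_size_ev (by simp) i
    have h2 : PolyLe (fun i => (g i).length) (fun i => size (ev (Γ ++ f :: g :: E) i)) :=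
      .of_le fun i => length_le_size_ev (by simp) i
    have h3 := ((PolyLe.const 4).mul h2).add (.const 1)
    exact (((PolyLe.const 2).mul h1).add (.const 1)).add (h3.add h3)

theorem dropLast (f : ι → List Bool) : Trans O (Γ ++ [f]) Γ := by
  refine of_bound (clearReg Γ.length) (fun i => 2 * (f i).length + 1) (fun i => ⟨_, le_rfl, ?_⟩)
    (((PolyLe.const 2).mul (.of_le fun i => length_le_size_ev (by simp) i)).add (.const 1))
  have h := runs_clearReg O Γ.length (st (ev (Γ ++ [f]) i))
  rw [ev_append, ev_cons, ← length_ev Γ i, update_st, st_length, ev_nil, st_append_nil,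
    length_ev] at h
  simpa using h

theorem dropOne (f : ι → List Bool) : Trans O (Γ ++ f :: E) (Γ ++ E) := by
  induction E generalizing Γ f with
  | nil => simpa using dropLast f
  | cons g E ih =>
    have := (swapClear (O := O) (Γ := Γ) (E := E) f g).trans
      (by simpa using ih (Γ := Γ ++ [g]) (fun _ => []))
    simpa using this

theorem drop (Γ Δ E : List (ι → List Bool)) : Trans O (Γ ++ (Δ ++ E)) (Γ ++ E) := by
  induction Δ with
  | nil => exact refl _ _
  | cons f Δ ih => exact (dropOne f).trans ih

theorem copies (h : ∀ f ∈ E, f ∈ Γ) : Trans O Γ (Γ ++ E) := by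
  induction E generalizing Γ with
  | nil => simpa using refl O Γ
  | cons f E ih =>
    have := (copy (O := O) (h f (by simp))).trans (ih (Γ := Γ ++ [f]) fun g hg => by
      simp [h g (by simp [hg])])
    simpa using this

end Trans

/-! ### Polynomial-time computation in a context: substitution, branching, loops -/

namespace Comp

variable {Γ Γ' Δ E : List (ι → List Bool)} {f g : ι → List Bool}

theorem var (h : f ∈ Γ) : Comp O Γ f := Trans.copy h

/-- Only membership matters, not order: copy `Γ` behind `Γ'`, compute there, and delete the copy. -/
theorem mono (h : Comp O Γ f) (hΓ : ∀ g ∈ Γ, g ∈ Γ') : Comp O Γ' f := by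
  have h1 : Trans O Γ' (Γ' ++ Γ) := Trans.copies hΓ
  exact (h1.trans (h.frame Γ')).trans (Trans.drop Γ' Γ [f])

theorem toTrans (h : ∀ f ∈ E, Comp O Γ f) : Trans O Γ (Γ ++ E) := by
  induction E generalizing Γ with
  | nil => simpa using Trans.refl O Γ
  | cons f E ih =>
    have := (h f (by simp)).trans (ih (Γ := Γ ++ [f]) fun g hg =>
      (h g (by simp [hg])).mono (by simp +contextual))
    simpa using this

theorem cut' (h : Trans O Γ (Γ ++ Δ)) (hg : Comp O (Γ ++ Δ) g) : Comp O Γ g := by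
  have := h.trans hg
  rw [List.append_assoc] at this
  exact this.trans (Trans.drop Γ Δ [g])

theorem cut (h : ∀ f ∈ Δ, Comp O Γ f) (hg : Comp O (Δ ++ Γ) g) : Comp O Γ g :=
  cut' (toTrans h) (hg.mono (by simp [or_comm]))

theorem bind (h : Comp O Γ f) (hg : Comp O (f :: Γ) g) : Comp O Γ g :=
  cut (Δ := [f]) (by simpa using h) hg

theorem reindex (h : Comp O Γ f) (φ : κ → ι) : Comp O (pull φ Γ) (fun k => f (φ k)) := by
  have := Trans.reindex h φ
  rwa [pull_append] at this

/-- The subroutine rule. The map `φ` sends an index of the caller to an instance of the subroutine,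
so preconditions can be put into the type `κ`. -/
theorem call {args : List (κ → List Bool)} {F : κ → List Bool} (hF : Comp O args F) (φ : ι → κ)
    (hargs : ∀ a ∈ args, Comp O Γ (fun i => a (φ i))) : Comp O Γ (fun i => F (φ i)) :=
  cut (Δ := pull φ args) (by simpa [pull] using hargs) ((hF.reindex φ).mono (by simp +contextual))

theorem polyLe (h : Comp O Γ f) : PolyLe (fun i => (f i).length) (fun i => size (ev Γ i)) :=
  h.size_le.mono fun i => length_le_size_ev (by simp) i

theorem congr (h : Comp O Γ f) (e : ∀ i, f i = g i) : Comp O Γ g := by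
  rwa [funext e] at h

theorem nil : Comp O Γ (fun _ => []) :=
  ⟨.skip, fun _ => 1, fun i => by simpa [st_append_nil] using Runs.skip _, .const 1⟩

theorem update_last (P : ℕ → Prog) (hf : Comp O Γ f)
    (hP : ∀ i k s, s k = f i → Runs O (P k) s (Function.update s k (g i)) 1) : Comp O Γ g := by
  refine Trans.trans hf ⟨P Γ.length, fun _ => 1, fun i => ?_, .const 1⟩
  have h := hP i Γ.length (st (ev (Γ ++ [f]) i)) (by
    simpa using st_length (ev Γ i) (f i) [])
  rw [ev_append, ev_cons, ← length_ev Γ i, update_st, length_ev] at h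
  simpa using h

theorem cons (b : Bool) (h : Comp O Γ f) : Comp O Γ (fun i => b :: f i) :=
  update_last (fun k => .push k b) h fun _ k s hs => hs ▸ .push k b s

theorem tail (h : Comp O Γ f) : Comp O Γ (fun i => (f i).tail) :=
  update_last (fun k => .pop k) h fun _ k s hs => hs ▸ .pop k s

open Classical in
theorem query (h : Comp O Γ f) : Comp O Γ (fun i => [decide (f i ∈ O)]) :=
  update_last (fun k => .query k) h fun i k s hs => by
    by_cases ho : f i ∈ O
    · simpa [ho] using Runs.queryYes k s (by rwa [hs])
    · simpa [ho] using Runs.queryNo k s (by rwa [hs])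

theorem const (l : List Bool) : Comp O Γ (fun _ => l) := by
  induction l with
  | nil => exact nil
  | cons b l ih => exact ih.cons b

/-- Each branch is required only for the indices that reach it. This makes it possible to test
validity first and then call a program that is specified only on valid inputs. -/
theorem branch {c : ι → List Bool} (hc : Comp O Γ c)
    (h0 : Comp O (pull (fun x : {i // c i = []} => x.1) Γ) (fun x => f x.1))
    (h1 : Comp O (pull (fun x : {i // ∃ l, c i = false :: l} => x.1) Γ) (fun x => f x.1))
    (h2 : Comp O (pull (fun x : {i // ∃ l, c i = true :: l} => x.1) Γ) (fun x => f x.1)) :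
    Comp O Γ f := by
  have hcl := hc.polyLe
  obtain ⟨P, t, hr, ht⟩ := hc
  obtain ⟨P0, p0, hr0⟩ := Trans.exists_poly h0
  obtain ⟨P1, p1, hr1⟩ := Trans.exists_poly h1
  obtain ⟨P2, p2, hr2⟩ := Trans.exists_poly h2
  refine Trans.of_bound (.seq P (.branch Γ.length P0 (.seq (clearReg Γ.length) P1)
    (.seq (clearReg Γ.length) P2)))
    (fun i => t i + ((2 * (c i).length + 2) + (p0.eval (size (ev Γ i)) + (p1.eval (size (ev Γ i))
      + p2.eval (size (ev Γ i)))))) (fun i => ?_) ?_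
  · have hcl : st (ev (Γ ++ [c]) i) Γ.length = c i := by
      simpa using st_length (ev Γ i) (c i) []
    have hclear : Runs O (clearReg Γ.length) (st (ev (Γ ++ [c]) i)) (st (ev Γ i))
        (2 * (c i).length + 1) := by
      refine runs_congr (runs_clearReg O Γ.length _) ?_ (by rw [hcl])
      rw [ev_append, ev_cons, ← length_ev Γ i, update_st, ev_nil, st_append_nil]
    match hci : c i with
    | [] =>
      obtain ⟨t0, b0, r0⟩ := hr0 ⟨i, hci⟩
      simp only [ev_append, ev_pull] at b0 r0
      refine ⟨_, ?_, .seq (hr i) (.branchEmpty (by rw [hcl, hci]) (t := t0) ?_)⟩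
      · simp
        omega
      · simpa [hci, st_append_nil] using r0
    | false :: l =>
      obtain ⟨t0, b0, r0⟩ := hr1 ⟨i, l, hci⟩
      simp only [ev_append, ev_pull] at b0 r0
      refine ⟨_, ?_, .seq (hr i) (.branchFalse (by rw [hcl, hci]) (.seq hclear (t' := t0) ?_))⟩
      · simp [hci]
        omega
      · simpa using r0
    | true :: l =>
      obtain ⟨t0, b0, r0⟩ := hr2 ⟨i, l, hci⟩
      simp only [ev_append, ev_pull] at b0 r0
      refine ⟨_, ?_, .seq (hr i) (.branchTrue (by rw [hcl, hci]) (.seq hclear (t' := t0) ?_))⟩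
      · simp [hci]
        omega
      · simpa using r0
  · refine ht.add ((((PolyLe.const 2).mul hcl).add (.const 2)).add ?_)
    exact PolyLe.add ⟨p0, fun i => le_rfl⟩ (PolyLe.add ⟨p1, fun i => le_rfl⟩ ⟨p2, fun i => le_rfl⟩)

theorem polyLe_size_ev {μ : Type} {S : List (μ → List Bool)} {b : μ → ℕ}
    (h : ∀ s ∈ S, PolyLe (fun x => (s x).length) b) : PolyLe (fun x => size (ev S x)) b := by
  induction S with
  | nil => exact .const 0
  | cons s S ih =>
    simpa using (h s (by simp)).add (ih fun s' hs' => h s' (by simp [hs']))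

/-- While loops: `s (i, j)` is the value of the variable `s` after `j` rounds, and `c` is the
variable that is tested for being nonempty. -/
theorem whileLoop {N : ι → ℕ} {c : ι × ℕ → List Bool} {S : List (ι × ℕ → List Bool)}
    (hc : ∀ i j, j < N i → c (i, j) ≠ []) (hcN : ∀ i, c (i, N i) = [])
    (hinit : ∀ s ∈ c :: S, Comp O Γ (fun i => s (i, 0)))
    (hstep : ∀ s ∈ c :: S, Comp O
      (pull (fun x : {x : ι × ℕ // x.2 < N x.1} => x.1.1) Γ ++ pull (fun x => x.1) (c :: S))
      (fun x => s (x.1.1, x.1.2 + 1)))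
    (hN : PolyLe N (fun i => size (ev Γ i)))
    (hbound : ∀ s ∈ c :: S, PolyLe (fun x : {x : ι × ℕ // x.2 ≤ N x.1} => (s x.1).length)
      (fun x => size (ev Γ x.1.1)))
    {s : ι × ℕ → List Bool} (hs : s ∈ c :: S) : Comp O Γ (fun i => s (i, N i)) := by
  have hbody := (toTrans (E := (c :: S).map
      (fun (s : ι × ℕ → List Bool) (x : {x : ι × ℕ // x.2 < N x.1}) => s (x.1.1, x.1.2 + 1))) (by
    intro f hf
    obtain ⟨s, hs, rfl⟩ := List.mem_map.1 hf
    exact hstep s hs))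
  rw [List.append_assoc] at hbody
  -- A round appends the new values and deletes the old ones, so the variables occupy the same
  -- registers in every round.
  obtain ⟨P, p, hP⟩ := (hbody.trans (Trans.drop _ _ _)).exists_poly
  -- Iterating a polynomial-time body could make sizes explode; bounding the variables of all rounds
  -- by the initial context gives one time bound per round.
  obtain ⟨q, hq⟩ : PolyLe (fun x : {x : ι × ℕ // x.2 ≤ N x.1} => size (ev (c :: S) x.1))
      (fun x => size (ev Γ x.1.1)) := by
    have := polyLe_size_ev (S := pull (fun x : {x : ι × ℕ // x.2 ≤ N x.1} => x.1) (c :: S))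
      (b := fun x => size (ev Γ x.1.1)) (by
        intro s' hs'
        obtain ⟨s, hs, rfl⟩ := List.mem_map.1 hs'
        exact hbound s hs)
    simpa only [ev_pull] using this
  have hinitT : Trans O Γ (Γ ++ pull (fun i => (i, 0)) (c :: S)) := toTrans (by
    intro f hf
    obtain ⟨s, hs, rfl⟩ := List.mem_map.1 hf
    exact hinit s hs)
  have hcst : ∀ i j, st (ev Γ i ++ ev (c :: S) (i, j)) Γ.length = c (i, j) := by
    intro i j
    rw [← length_ev Γ i]
    exact st_length _ _ _
  have hloop : ∀ i d j, j + d = N i →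
      ∃ t ≤ d * (p.eval (size (ev Γ i) + q.eval (size (ev Γ i))) + 1) + 1,
        Runs O (.loop Γ.length P) (st (ev Γ i ++ ev (c :: S) (i, j)))
          (st (ev Γ i ++ ev (c :: S) (i, N i))) t := by
    intro i d
    induction d with
    | zero =>
      intro j hj
      obtain rfl : j = N i := by omega
      exact ⟨1, by omega, .loopDone (by rw [hcst, hcN])⟩
    | succ d ih =>
      intro j hj
      obtain ⟨t', ht', hr'⟩ := ih (j + 1) (by omega)
      obtain ⟨t, ht, hr⟩ := hP ⟨(i, j), by simp; omega⟩
      refine ⟨_, ?_, .loopStep (t := t) (by rw [hcst]; exact hc i j (by omega)) ?_ hr'⟩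
      · have h1 := hq ⟨(i, j), by simp; omega⟩
        have h2 : size (ev Γ i) + size (ev (c :: S) (i, j))
            ≤ size (ev Γ i) + q.eval (size (ev Γ i)) := Nat.add_le_add_left h1 _
        have h3 := eval_mono p h2
        rw [ev_append, size_append, ev_pull, ev_pull] at ht
        have h4 := ht.trans h3
        rw [Nat.succ_mul]
        omega
      · rw [ev_append, ev_append, ev_pull, ev_pull] at hr
        convert hr using 3
        simp [ev]
  refine cut' (Δ := pull (fun i => (i, N i)) (c :: S)) (hinitT.trans ?_)
    (var (List.mem_append_right _ (mem_pull hs)))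
  refine Trans.of_bound (.loop Γ.length P)
    (fun i => N i * (p.eval (size (ev Γ i) + q.eval (size (ev Γ i))) + 1) + 1) (fun i => ?_) ?_
  · obtain ⟨t, ht, hr⟩ := hloop i (N i) 0 (by omega)
    rw [ev_append, ev_append, ev_pull, ev_pull]
    exact ⟨t, ht, hr⟩
  · refine PolyLe.trans (g := fun i => size (ev Γ i)) ?_ (.of_le fun i => by simp)
    refine (hN.mul (PolyLe.add ?_ (.const 1))).add (.const 1)
    exact ⟨p.comp (Polynomial.X + q), fun i => by simp⟩

theorem toPolyTime (h : Comp O Γ f) {inp : ι → List (List Bool)} (hinp : ∀ i, ev Γ i = inp i) :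
    PolyTime O inp f := by
  obtain ⟨P, p, hP⟩ := (h.trans (by simpa using Trans.drop [] Γ [f])).exists_poly
  refine ⟨P, p, fun i => ?_⟩
  obtain ⟨t, ht, hr⟩ := hP i
  rw [hinp] at ht hr
  exact ⟨_, t, hr, rfl, ht⟩

theorem ofPolyTime {inp : ι → List (List Bool)} (h : PolyTime O inp f)
    (hinp : ∀ i, ev Γ i = inp i) : Comp O Γ f := by
  obtain ⟨P, p, hP⟩ := h
  choose s t hr h0 ht using hP
  -- Beyond `K` nothing is touched and nothing was there initially, so the final state is the output
  -- followed by the finite junk list `G`, which can be deleted.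
  set K := max (regBound P) Γ.length
  set G : List (ι → List Bool) := (List.range K).map (fun j i => s i (j + 1))
  have hT : Trans O Γ (f :: G) := by
    refine ⟨P, t, fun i => runs_congr (hinp i ▸ hr i) ?_ rfl, p, fun i => by
      simpa only [hinp, size] using ht i⟩
    funext j
    cases j with
    | zero => simpa [st] using h0 i
    | succ j =>
      by_cases hj : j < K
      · simp [st, ev, G, List.getD, hj]
      · rw [st_of_le _ _ (by simp [G]; omega), runs_unchanged (hr i) (by omega), ← hinp]
        exact st_of_le _ _ (by simp; omega)
  have h1 : Trans O (Γ ++ Γ) (Γ ++ ([f] ++ G)) := hT.frame Γ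
  have h2 : Trans O (Γ ++ [f] ++ (G ++ [])) (Γ ++ [f] ++ []) := Trans.drop _ _ _
  have h3 : Trans O Γ (Γ ++ Γ) := Trans.copies fun f hf => hf
  exact (h3.trans h1).trans (by simpa using h2)

end Comp

end StackMachine

namespace StackMachine

/-! ### Computable functions on strings -/

variable {O : Set (List Bool)} {ι κ : Type}

theorem pull_pull {μ : Type} (φ : κ → ι) (ψ : μ → κ) (Γ : List (ι → List Bool)) :
    pull ψ (pull φ Γ) = pull (fun k => φ (ψ k)) Γ := by
  simp [pull]

namespace Comp

variable {Γ Δ : List (ι → List Bool)} {f g : ι → List Bool} {b c : ι → Bool}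

theorem split (hb : Comp O Γ (fun i => [b i]))
    (ht : Comp O (pull (fun x : {i // b i = true} => x.1) Γ) (fun x => f x.1))
    (hf : Comp O (pull (fun x : {i // b i = false} => x.1) Γ) (fun x => f x.1)) :
    Comp O Γ f := by
  refine hb.branch ?_ ?_ ?_
  · exact ⟨.skip, fun _ => 1, fun x => absurd x.2 (by simp), .const 1⟩
  · have := hf.reindex (fun x : {i // ∃ l, [b i] = false :: l} => ⟨x.1, by simpa using x.2⟩)
    rwa [pull_pull] at this
  · have := ht.reindex (fun x : {i // ∃ l, [b i] = true :: l} => ⟨x.1, by simpa using x.2⟩)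
    rwa [pull_pull] at this

theorem ite (hb : Comp O Γ (fun i => [b i])) (hf : Comp O Γ f) (hg : Comp O Γ g) :
    Comp O Γ (fun i => if b i then f i else g i) :=
  hb.split ((hf.reindex _).congr fun x => by simp [x.2]) ((hg.reindex _).congr fun x => by
    simp [x.2])

theorem not (hb : Comp O Γ (fun i => [b i])) : Comp O Γ (fun i => [!b i]) :=
  (hb.ite (const [false]) (const [true])).congr fun i => by cases b i <;> rfl

theorem and (hb : Comp O Γ (fun i => [b i])) (hc : Comp O Γ (fun i => [c i])) :
    Comp O Γ (fun i => [b i && c i]) :=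
  (hb.ite hc (const [false])).congr fun i => by cases b i <;> rfl

theorem or (hb : Comp O Γ (fun i => [b i])) (hc : Comp O Γ (fun i => [c i])) :
    Comp O Γ (fun i => [b i || c i]) :=
  (hb.ite (const [true]) hc).congr fun i => by cases b i <;> rfl

theorem isEmpty (hf : Comp O Γ f) : Comp O Γ (fun i => [(f i).isEmpty]) := by
  refine hf.branch ((const [true]).congr fun x => ?_) ((const [false]).congr fun x => ?_)
    ((const [false]).congr fun x => ?_)
  · simp [x.2]
  · obtain ⟨l, hl⟩ := x.2
    simp [hl]
  · obtain ⟨l, hl⟩ := x.2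
    simp [hl]

theorem head (hf : Comp O Γ f) : Comp O Γ (fun i => [(f i).headD false]) := by
  refine hf.branch ((const [false]).congr fun x => ?_) ((const [false]).congr fun x => ?_)
    ((const [true]).congr fun x => ?_)
  · simp [x.2]
  · obtain ⟨l, hl⟩ := x.2
    simp [hl]
  · obtain ⟨l, hl⟩ := x.2
    simp [hl]

theorem consBit (hb : Comp O Γ (fun i => [b i])) (hf : Comp O Γ f) :
    Comp O Γ (fun i => b i :: f i) :=
  (hb.ite (hf.cons true) (hf.cons false)).congr fun i => by cases b i <;> rfl

theorem weaken_right (h : Comp O Γ f) : Comp O (Γ ++ Δ) f := h.mono (by simp +contextual)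

/-- A while loop whose variables are the unread part of `l`, which is also the loop test, and the
accumulator. The last hypothesis bounds all intermediate accumulators. -/
theorem foldl {l a : ι → List Bool} {g : ι → List Bool → Bool → List Bool}
    (hl : Comp O Γ l) (ha : Comp O Γ a)
    (hg : Comp O (pull (fun x : ι × List Bool × Bool => x.1) Γ ++
      [fun x => x.2.1, fun x => [x.2.2]]) (fun x => g x.1 x.2.1 x.2.2))
    (hb : PolyLe (fun x : {x : ι × ℕ // x.2 ≤ (l x.1).length} =>
      (((l x.1.1).take x.1.2).foldl (g x.1.1) (a x.1.1)).length) (fun x => size (ev Γ x.1.1))) :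
    Comp O Γ (fun i => (l i).foldl (g i) (a i)) := by
  have := whileLoop (O := O) (Γ := Γ) (N := fun i => (l i).length)
    (c := fun x => (l x.1).drop x.2)
    (S := [fun x => ((l x.1).take x.2).foldl (g x.1) (a x.1)])
    (s := fun x => ((l x.1).take x.2).foldl (g x.1) (a x.1))
    (fun i j hj => by simpa using hj) (fun i => by simp) ?_ ?_ hl.polyLe ?_ (by simp)
  · simpa using this
  · intro s hs
    simp only [List.mem_cons, List.not_mem_nil, or_false] at hs
    rcases hs with rfl | rfl
    · simpa using hl
    · simpa using ha
  · intro s hs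
    simp only [List.mem_cons, List.not_mem_nil, or_false] at hs
    rcases hs with rfl | rfl
    · refine (tail (var (f := fun x => (l x.1.1).drop x.1.2) ?_)).congr fun x => ?_
      · simp
      · simp
    · refine (hg.call (fun x : {x : ι × ℕ // x.2 < (l x.1).length} => (x.1.1,
        ((l x.1.1).take x.1.2).foldl (g x.1.1) (a x.1.1),
        ((l x.1.1).drop x.1.2).headD false)) ?_).congr fun x => ?_
      · intro f hf
        simp only [List.mem_append, List.mem_cons, List.not_mem_nil, or_false] at hf
        rcases hf with hf | rfl | rfl
        · obtain ⟨f', hf', rfl⟩ := List.mem_map.1 hf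
          exact var (List.mem_append_left _ (mem_pull hf'))
        · exact var (by simp)
        · exact head (var (by simp))
      · have hx := x.2
        simp only [List.take_add_one, List.foldl_append, List.getElem?_eq_getElem hx,
          List.drop_eq_getElem_cons hx, List.headD_cons]
        simp
  · intro s hs
    simp only [List.mem_cons, List.not_mem_nil, or_false] at hs
    rcases hs with rfl | rfl
    · refine PolyLe.mono (f := fun x => ((l x.1.1).drop x.1.2).length) (fun x => ?_)
        (hl.polyLe.reindex (fun x : {x : ι × ℕ // x.2 ≤ (l x.1).length} => x.1.1))
      simp
    · exact hb

/-- A convenient special case of `Comp.foldl`. -/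
theorem foldl_of_le {l a : ι → List Bool} {g : ι → List Bool → Bool → List Bool} {B : ι → ℕ}
    (hl : Comp O Γ l) (ha : Comp O Γ a)
    (hg : Comp O (pull (fun x : ι × List Bool × Bool => x.1) Γ ++
      [fun x => x.2.1, fun x => [x.2.2]]) (fun x => g x.1 x.2.1 x.2.2))
    (hB : PolyLe B (fun i => size (ev Γ i)))
    (hgB : ∀ i acc c, (g i acc c).length ≤ acc.length + B i) :
    Comp O Γ (fun i => (l i).foldl (g i) (a i)) := by
  refine foldl hl ha hg (PolyLe.mono (g := fun x => (a x.1.1).length + (l x.1.1).length * B x.1.1)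
    (fun x => ?_) ((ha.polyLe.add (hl.polyLe.mul hB)).reindex (fun x : {x : ι × ℕ //
      x.2 ≤ (l x.1).length} => x.1.1)))
  have aux : ∀ (m acc : List Bool), (m.foldl (g x.1.1) acc).length
      ≤ acc.length + m.length * B x.1.1 := by
    intro m
    induction m with
    | nil => simp
    | cons c m ih =>
      intro acc
      have h1 := ih (g x.1.1 acc c)
      have h2 := hgB x.1.1 acc c
      simp only [List.foldl_cons, List.length_cons, Nat.succ_mul]
      omega
  refine (aux _ _).trans ?_
  gcongr
  simp

theorem reverseAppend (hf : Comp O Γ f) (hg : Comp O Γ g) :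
    Comp O Γ (fun i => (f i).reverse ++ g i) := by
  refine (foldl_of_le (g := fun _ acc c => c :: acc) (B := fun _ => 1) hf hg ?_ (.const 1)
    (by simp)).congr fun i => ?_
  · exact consBit (var (by simp)) (var (by simp))
  · generalize g i = l
    induction f i generalizing l with
    | nil => rfl
    | cons a m ih => simp [ih]

theorem reverse (hf : Comp O Γ f) : Comp O Γ (fun i => (f i).reverse) :=
  (hf.reverseAppend nil).congr fun i => by simp

theorem append (hf : Comp O Γ f) (hg : Comp O Γ g) : Comp O Γ (fun i => f i ++ g i) :=
  (hf.reverse.reverseAppend hg).congr fun i => by simp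

theorem replicateLength (b : Bool) (hf : Comp O Γ f) :
    Comp O Γ (fun i => List.replicate (f i).length b) := by
  refine (foldl_of_le (g := fun _ acc _ => b :: acc) (B := fun _ => 1) hf nil ?_ (.const 1)
    (by simp)).congr fun i => ?_
  · exact cons b (var (by simp))
  · simp

theorem drop' {k : ι → List Bool} (hf : Comp O Γ f) (hk : Comp O Γ k) :
    Comp O Γ (fun i => (f i).drop (k i).length) := by
  refine (foldl_of_le (g := fun _ acc _ => acc.tail) (B := fun _ => 0) hk hf ?_ (.const 0)
    (by simp)).congr fun i => ?_
  · exact tail (var (by simp))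
  · generalize f i = l
    induction k i generalizing l with
    | nil => rfl
    | cons a m ih => simp [ih]

theorem decideEq (hf : Comp O Γ f) (hg : Comp O Γ g) : Comp O Γ (fun i => [decide (f i = g i)]) := by
  -- The accumulator is a flag `true` followed by the part of `g` not yet matched, and becomes `[]`
  -- for good after a mismatch. The strings agree exactly when it ends as `[true]`.
  let step : List Bool → Bool → List Bool := fun acc c =>
    if acc.headD false && (!acc.tail.isEmpty && (acc.tail.headD false == c)) then true :: acc.tail.tail else []
  have hstep : Comp O (pull (fun x : ι × List Bool × Bool => x.1) Γ ++
      [fun x => x.2.1, fun x => [x.2.2]]) (fun x => step x.2.1 x.2.2) := by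
    have hacc : Comp O (pull (fun x : ι × List Bool × Bool => x.1) Γ ++
      [fun x => x.2.1, fun x => [x.2.2]]) (fun x => x.2.1) := var (by simp)
    have hc : Comp O (pull (fun x : ι × List Bool × Bool => x.1) Γ ++
      [fun x => x.2.1, fun x => [x.2.2]]) (fun x => [x.2.2]) := var (by simp)
    refine ite (hacc.head.and (hacc.tail.isEmpty.not.and ?_)) (hacc.tail.tail.cons true) nil
    refine (hc.ite hacc.tail.head hacc.tail.head.not).congr fun x => ?_
    cases x.2.2 <;> cases x.2.1.tail.headD false <;> rfl
  have h := foldl_of_le (g := fun _ => step) (B := fun _ => 1) hf (hg.cons true) hstep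
    (.const 1) (fun i acc c => by
      simp only [step]
      split_ifs
      · simp
        omega
      · simp)
  refine (h.tail.isEmpty.and h.head).congr fun i => ?_
  have h0 : ∀ l : List Bool, l.foldl step [] = [] := by
    intro l
    induction l with
    | nil => rfl
    | cons a l ih => simpa [step] using ih
  have : ∀ l m : List Bool, ((l.foldl step (true :: m)).tail.isEmpty
      && (l.foldl step (true :: m)).headD false) = decide (l = m) := by
    intro l
    induction l with
    | nil => intro m; cases m <;> simp
    | cons a l ih =>
      intro m
      cases m with
      | nil =>
        have : step [true] a = [] := by simp [step]
        rw [List.foldl_cons, this, h0]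
        simp
      | cons b m =>
        by_cases hab : b = a
        · subst hab
          simpa [step] using ih m
        · have : step (true :: b :: m) a = [] := by simp [step, hab]
          rw [List.foldl_cons, this, h0]
          simp [Ne.symm hab]
  rw [this]

end Comp

/-! ### Computable numbers, in unary -/

/-- The number `x`, in unary, is computable in polynomial time in the context `Γ`. -/
def CompN (O : Set (List Bool)) {ι : Type} (Γ : List (ι → List Bool)) (x : ι → ℕ) : Prop :=
  Comp O Γ (fun i => List.replicate (x i) true)

namespace Comp

variable {Γ : List (ι → List Bool)} {f g : ι → List Bool} {b c : ι → Bool} {x y : ι → ℕ}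

theorem length (hf : Comp O Γ f) : CompN O Γ (fun i => (f i).length) := hf.replicateLength true

theorem replicate (b : Bool) (hx : CompN O Γ x) : Comp O Γ (fun i => List.replicate (x i) b) :=
  (replicateLength b hx).congr fun i => by simp

theorem drop (hf : Comp O Γ f) (hx : CompN O Γ x) : Comp O Γ (fun i => (f i).drop (x i)) :=
  (hf.drop' hx).congr fun i => by simp

theorem take (hf : Comp O Γ f) (hx : CompN O Γ x) : Comp O Γ (fun i => (f i).take (x i)) :=
  (hf.reverse.drop (hf.drop hx).length).reverse.congr fun i => by
    rw [List.drop_reverse, List.reverse_reverse, List.length_drop]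
    rcases le_total (x i) (f i).length with h | h
    · congr 1
      omega
    · rw [List.take_of_length_le (by omega), List.take_of_length_le h]

/-- The first `x` bits, padded with `false` if there are less of them. -/
theorem takePad (hf : Comp O Γ f) (hx : CompN O Γ x) :
    Comp O Γ (fun i => (f i ++ List.replicate (x i) false).take (x i)) :=
  (hf.append (Comp.replicate false hx)).take hx

end Comp

namespace CompN

variable {Γ : List (ι → List Bool)} {f g : ι → List Bool} {b c : ι → Bool} {x y : ι → ℕ}

theorem congr (h : CompN O Γ x) (e : ∀ i, x i = y i) : CompN O Γ y := by
  rwa [funext e] at h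

theorem polyLe (h : CompN O Γ x) : PolyLe x (fun i => size (ev Γ i)) := by
  simpa using Comp.polyLe h

theorem const (n : ℕ) : CompN O Γ (fun _ => n) := Comp.const _

theorem succ (hx : CompN O Γ x) : CompN O Γ (fun i => x i + 1) := Comp.cons true hx

theorem add (hx : CompN O Γ x) (hy : CompN O Γ y) : CompN O Γ (fun i => x i + y i) :=
  (Comp.append hx hy).congr fun i => by simp

theorem sub (hx : CompN O Γ x) (hy : CompN O Γ y) : CompN O Γ (fun i => x i - y i) :=
  (Comp.drop hx hy).congr fun i => by simp

theorem mul (hx : CompN O Γ x) (hy : CompN O Γ y) : CompN O Γ (fun i => x i * y i) := by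
  refine (Comp.foldl_of_le (g := fun i acc _ => List.replicate (y i) true ++ acc) (B := y)
    hx Comp.nil ?_ hy.polyLe (fun i acc c => by simp [add_comm])).congr fun i => ?_
  · exact Comp.append (Comp.reindex hy (fun x : ι × List Bool × Bool => x.1)).weaken_right
      (Comp.var (by simp))
  · simp

theorem eval (p : Polynomial ℕ) (hx : CompN O Γ x) : CompN O Γ (fun i => p.eval (x i)) := by
  induction p using Polynomial.induction_on with
  | C a => simpa using const a
  | add p q hp hq => simpa using hp.add hq
  | monomial n a h =>
    refine (h.mul hx).congr fun i => ?_
    simp [pow_succ, mul_assoc]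

theorem decideLe (hx : CompN O Γ x) (hy : CompN O Γ y) :
    Comp O Γ (fun i => [decide (x i ≤ y i)]) :=
  (Comp.isEmpty (hx.sub hy)).congr fun i => by
    rw [List.isEmpty_replicate]
    simp [Nat.sub_eq_zero_iff_le]

theorem decideEq (hx : CompN O Γ x) (hy : CompN O Γ y) :
    Comp O Γ (fun i => [decide (x i = y i)]) :=
  (Comp.decideEq hx hy).congr fun i => by simp

end CompN

end StackMachine

namespace StackMachine

/-! ### Self-delimiting encoding of tuples -/

/-- Every string is preceded by its length in unary. -/
def enc : List (List Bool) → List Bool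
  | [] => []
  | a :: l => List.replicate a.length true ++ false :: (a ++ enc l)

/-- The number of leading ones. -/
def leadingOnes (x : List Bool) : ℕ := (x.takeWhile id).length

/-- The first component of an encoded tuple. -/
def decHead (x : List Bool) : List Bool := (x.drop (leadingOnes x + 1)).take (leadingOnes x)

/-- The encoded tuple without its first component. -/
def decTail (x : List Bool) : List Bool := x.drop (leadingOnes x + 1 + leadingOnes x)

theorem leadingOnes_replicate (k : ℕ) (l : List Bool) :
    leadingOnes (List.replicate k true ++ false :: l) = k := by
  induction k with
  | zero => rfl
  | succ k ih => simp [leadingOnes, List.replicate_succ]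

theorem decHead_enc (a : List Bool) (l : List (List Bool)) : decHead (enc (a :: l)) = a := by
  rw [decHead, enc, leadingOnes_replicate]
  simp [List.drop_append]

theorem decTail_enc (a : List Bool) (l : List (List Bool)) : decTail (enc (a :: l)) = enc l := by
  rw [decTail, enc, leadingOnes_replicate]
  simp [List.drop_append]

theorem length_enc (l : List (List Bool)) : (enc l).length = 2 * size l + l.length := by
  induction l with
  | nil => rfl
  | cons a l ih =>
    simp [enc, ih]
    omega

/-! ### Lists of points, written as chunks of the same length -/

/-- Flip the last bit. -/
def flipLast (c : List Bool) : List Bool := c.reverse.tail.reverse ++ [!(c.reverse.headD false)]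

theorem flipLast_append (l : List Bool) (b : Bool) : flipLast (l ++ [b]) = l ++ [!b] := by
  simp [flipLast]

theorem length_flipLast {c : List Bool} {n : ℕ} (h : c.length = n + 1) :
    (flipLast c).length = n + 1 := by
  simp [flipLast, h]

/-- Flip the last bit of a chunk marked by `true`, and keep it unless it is there already. -/
def pick (acc : List (List Bool)) (z : List Bool × Bool) : List (List Bool) :=
  if z.2 && !decide (flipLast z.1 ∈ acc) then acc ++ [flipLast z.1] else acc

theorem mem_foldl_pick {Z : List (List Bool × Bool)} {acc : List (List Bool)} {c : List Bool}
    (h : c ∈ Z.foldl pick acc) : c ∈ acc ∨ ∃ z ∈ Z, c = flipLast z.1 := by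
  induction Z generalizing acc with
  | nil => exact Or.inl h
  | cons z Z ih =>
    rcases ih h with h | ⟨z', hz', h⟩
    · unfold pick at h
      split_ifs at h with hz
      · rcases List.mem_append.1 h with h | h
        · exact Or.inl h
        · exact Or.inr ⟨z, by simp, by simpa using h⟩
      · exact Or.inl h
    · exact Or.inr ⟨z', by simp [hz'], h⟩

/-- The selection is a set even if the dataset has repetitions. This matters for random samples,
since the property of `A` on totally incorrect data is available only for sets. -/
theorem nodup_foldl_pick (Z : List (List Bool × Bool)) {acc : List (List Bool)}
    (h : acc.Nodup) : (Z.foldl pick acc).Nodup := by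
  induction Z generalizing acc with
  | nil => exact h
  | cons z Z ih =>
    refine ih ?_
    unfold pick
    split_ifs with hz
    · simp only [Bool.and_eq_true, Bool.not_eq_true', decide_eq_false_iff_not] at hz
      exact List.nodup_append.2 ⟨h, by simp, by
        rintro a ha b hb rfl
        exact hz.2 (by simpa [List.mem_singleton.1 hb] using ha)⟩
    · exact h

theorem length_foldl_pick (Z : List (List Bool × Bool)) (acc : List (List Bool)) :
    (Z.foldl pick acc).length ≤ acc.length + Z.length := by
  induction Z generalizing acc with
  | nil => simp
  | cons z Z ih =>
    refine (ih _).trans ?_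
    have : (pick acc z).length ≤ acc.length + 1 := by
      unfold pick
      split_ifs <;> simp
    simp only [List.length_cons]
    omega

/-- Mark the members of the sublist. Since the flipped chunks are distinct from each other and from
`acc`, the membership test in `pick` never discards a marked one. -/
theorem exists_mask {W D : List (List Bool)} (h : W.Sublist D) {acc : List (List Bool)}
    (hn : (acc ++ W.map flipLast).Nodup) : ∃ mask : List Bool, mask.length = D.length ∧
      (D.zip mask).foldl pick acc = acc ++ W.map flipLast := by
  induction h generalizing acc with
  | slnil => exact ⟨[], rfl, by simp⟩
  | cons a h ih =>
    obtain ⟨mask, hm, he⟩ := ih hn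
    exact ⟨false :: mask, by simp [hm], by simpa [pick] using he⟩
  | cons_cons a h ih =>
    rw [List.map_cons, ← List.singleton_append, ← List.append_assoc] at hn
    obtain ⟨mask, hm, he⟩ := ih hn
    refine ⟨true :: mask, by simp [hm], ?_⟩
    have ha : flipLast a ∉ acc := fun ha =>
      (List.nodup_append.1 (List.nodup_append.1 hn).1).2.2 _ ha _ (by simp) rfl
    rw [List.zip_cons_cons, List.foldl_cons, pick]
    simpa [ha] using he

theorem length_flatten_chunks {D : List (List Bool)} {k : ℕ} (h : ∀ c ∈ D, c.length = k) :
    D.flatten.length = D.length * k := by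
  rw [List.length_flatten, List.map_congr_left h]
  simp

variable {O : Set (List Bool)} {ι κ : Type}

/-! ### Polynomial-time operations on tuples and on lists of chunks -/

namespace Comp

variable {Γ : List (ι → List Bool)} {f g : ι → List Bool} {n : ι → ℕ}

theorem leadingOnes (hf : Comp O Γ f) : CompN O Γ (fun i => leadingOnes (f i)) := by
  refine Comp.length (f := fun i => (f i).takeWhile id) ?_
  refine (foldl_of_le (g := fun _ acc c => if c then true :: acc else []) (B := fun _ => 1)
    hf.reverse nil ?_ (.const 1) (fun i acc c => by cases c <;> simp)).congr fun i => ?_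
  · exact ite (var (by simp)) (cons true (var (by simp))) nil
  · rw [List.foldl_reverse]
    induction f i with
    | nil => rfl
    | cons b l ih =>
      cases b with
      | false => simp
      | true => simpa using ih

theorem decHead (hf : Comp O Γ f) : Comp O Γ (fun i => decHead (f i)) :=
  (hf.drop hf.leadingOnes.succ).take hf.leadingOnes

theorem decTail (hf : Comp O Γ f) : Comp O Γ (fun i => decTail (f i)) :=
  hf.drop (hf.leadingOnes.succ.add hf.leadingOnes)

theorem enc {L : List (ι → List Bool)} (hL : ∀ f ∈ L, Comp O Γ f) :
    Comp O Γ (fun i => enc (ev L i)) := by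
  induction L with
  | nil => exact nil
  | cons f L ih =>
    have hf := hL f (by simp)
    exact (replicateLength true hf).append ((hf.append (ih fun g hg => hL g (by simp [hg]))).cons false)

/-- Loops over the chunks of a list `D`. -/
theorem chunkLoop {D : ι → List (List Bool)} (hD : ∀ i, ∀ c ∈ D i, c.length = n i + 1)
    (hn : CompN O Γ n) (hDc : Comp O Γ (fun i => (D i).flatten)) {S : List (ι × ℕ → List Bool)}
    (hinit : ∀ s ∈ S, Comp O Γ (fun i => s (i, 0)))
    (hstep : ∀ s ∈ S, Comp O
      ((fun x : {x : ι × ℕ // x.2 < (D x.1).length} => (D x.1.1).getD x.1.2 []) ::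
        (pull (fun x => x.1.1) Γ ++ pull (fun x => x.1) S))
      (fun x => s (x.1.1, x.1.2 + 1)))
    (hbound : ∀ s ∈ S, PolyLe (fun x : {x : ι × ℕ // x.2 ≤ (D x.1).length} => (s x.1).length)
      (fun x => size (ev Γ x.1.1)))
    {s : ι × ℕ → List Bool} (hs : s ∈ S) : Comp O Γ (fun i => s (i, (D i).length)) := by
  have hdrop : ∀ i j, j < (D i).length →
      ((D i).drop j).flatten = (D i).getD j [] ++ ((D i).drop (j + 1)).flatten ∧
        ((D i).getD j []).length = n i + 1 := by
    intro i j hj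
    rw [List.drop_eq_getElem_cons hj, List.getD_eq_getElem _ _ hj]
    exact ⟨List.flatten_cons, hD i _ (List.getElem_mem hj)⟩
  have hlen : ∀ i, (D i).length ≤ (D i).flatten.length := fun i => by
    rw [length_flatten_chunks (hD i)]
    exact Nat.le_mul_of_pos_right _ (Nat.succ_pos _)
  refine whileLoop (c := fun x => ((D x.1).drop x.2).flatten) (S := S) (fun i j hj h => ?_)
    (fun i => by simp) ?_ ?_ (hDc.polyLe.mono hlen) ?_ (List.mem_cons_of_mem _ hs)
  · have h1 := hdrop i j hj
    have h2 := congrArg List.length (h1.1.symm.trans h)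
    simp only [List.length_append, List.length_nil] at h2
    omega
  · intro s hs
    rcases List.mem_cons.1 hs with rfl | hs
    · simpa using hDc
    · exact hinit s hs
  · have hn' := Comp.weaken_right (Δ := pull (fun x : {x : ι × ℕ // x.2 < (D x.1).length} => x.1)
      ((fun x => ((D x.1).drop x.2).flatten) :: S)) (Comp.reindex hn (fun x => x.1.1))
    have hc : Comp O (pull (fun x : {x : ι × ℕ // x.2 < (D x.1).length} => x.1.1) Γ ++
        pull (fun x => x.1) ((fun x => ((D x.1).drop x.2).flatten) :: S))
        (fun x => ((D x.1.1).drop x.1.2).flatten) := var (by simp)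
    intro s hs
    rcases List.mem_cons.1 hs with rfl | hs
    · refine (hc.drop (CompN.succ hn')).congr fun x => ?_
      have h1 := hdrop x.1.1 x.1.2 x.2
      rw [h1.1, ← h1.2]
      simp
    · refine bind (f := fun x => (D x.1.1).getD x.1.2 [])
        ((hc.take (CompN.succ hn')).congr fun x => ?_) ((hstep s hs).mono ?_)
      · have h1 := hdrop x.1.1 x.1.2 x.2
        rw [h1.1, ← h1.2]
        simp
      · intro g hg
        simp only [List.mem_cons, List.mem_append, pull_cons] at hg ⊢
        tauto
  · intro s hs
    rcases List.mem_cons.1 hs with rfl | hs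
    · refine PolyLe.mono (fun x => ?_)
        (hDc.polyLe.reindex (fun x : {x : ι × ℕ // x.2 ≤ (D x.1).length} => x.1.1))
      exact ((List.drop_sublist _ _).flatten).length_le
    · exact hbound s hs

theorem countChunks {D : ι → List (List Bool)} (hD : ∀ i, ∀ c ∈ D i, c.length = n i + 1)
    (hn : CompN O Γ n) (hDc : Comp O Γ (fun i => (D i).flatten)) :
    CompN O Γ (fun i => (D i).length) := by
  refine chunkLoop hD hn hDc (S := [fun x => List.replicate x.2 true])
    (s := fun x => List.replicate x.2 true) ?_ ?_ ?_ (by simp)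
  · intro s hs
    obtain rfl := List.mem_singleton.1 hs
    exact nil
  · intro s hs
    obtain rfl := List.mem_singleton.1 hs
    exact cons true (var (by simp))
  · intro s hs
    obtain rfl := List.mem_singleton.1 hs
    refine PolyLe.mono (fun x => ?_)
        (hDc.polyLe.reindex (fun x : {x : ι × ℕ // x.2 ≤ (D x.1).length} => x.1.1))
    rw [length_flatten_chunks (hD _), List.length_replicate]
    exact x.2.trans (Nat.le_mul_of_pos_right _ (Nat.succ_pos _))

theorem memChunks {D : ι → List (List Bool)} (hD : ∀ i, ∀ c ∈ D i, c.length = n i + 1)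
    (hn : CompN O Γ n) (hDc : Comp O Γ (fun i => (D i).flatten)) (hf : Comp O Γ f) :
    Comp O Γ (fun i => [decide (f i ∈ D i)]) := by
  have := chunkLoop hD hn hDc (S := [fun x => [decide (f x.1 ∈ (D x.1).take x.2)]])
    (s := fun x => [decide (f x.1 ∈ (D x.1).take x.2)]) ?_ ?_ ?_ (by simp)
  · simpa using this
  · intro s hs
    obtain rfl := List.mem_singleton.1 hs
    exact (const [false]).congr fun i => by simp
  · intro s hs
    obtain rfl := List.mem_singleton.1 hs
    refine (or (b := fun x => decide (f x.1.1 ∈ (D x.1.1).take x.1.2)) (var (by simp))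
      (decideEq (f := fun x => f x.1.1) ((hf.reindex (fun x : {x : ι × ℕ // x.2 < (D x.1).length} => x.1.1)).mono
        fun g hg => List.mem_cons_of_mem _ (List.mem_append_left _ hg))
      (var (f := fun x => (D x.1.1).getD x.1.2 []) (by simp)))).congr fun x => ?_
    · obtain ⟨⟨i, j⟩, hx⟩ := x
      replace hx : j < (D i).length := hx
      simp only [List.take_add_one, List.getElem?_eq_getElem hx, List.getD_eq_getElem _ _ hx,
        Option.toList, List.mem_append, List.mem_singleton, Bool.decide_or]
  · intro s hs
    obtain rfl := List.mem_singleton.1 hs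
    exact PolyLe.const 1

theorem flipLast (hf : Comp O Γ f) : Comp O Γ (fun i => flipLast (f i)) :=
  hf.reverse.tail.reverse.append hf.reverse.head.not

theorem pickChunks {D : ι → List (List Bool)} (hD : ∀ i, ∀ c ∈ D i, c.length = n i + 1)
    (hn : CompN O Γ n) (hDc : Comp O Γ (fun i => (D i).flatten)) {m : ι → List Bool}
    (hm : Comp O Γ m) (hml : ∀ i, (D i).length ≤ (m i).length) :
    Comp O Γ (fun i => (((D i).zip (m i)).foldl pick []).flatten) := by
  let E : ι × ℕ → List (List Bool) := fun x => (((D x.1).zip (m x.1)).take x.2).foldl pick []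
  have hE : ∀ x, ∀ c ∈ E x, c.length = n x.1 + 1 := by
    intro x c hc
    rcases mem_foldl_pick hc with h | ⟨z, hz, rfl⟩
    · simp at h
    · exact length_flipLast (hD _ _ (List.of_mem_zip (List.mem_of_mem_take hz)).1)
  -- The loop variables are the chunks selected so far and the unread part of the mask.
  have := chunkLoop hD hn hDc (S := [fun x => (E x).flatten, fun x => (m x.1).drop x.2])
    (s := fun x => (E x).flatten) ?_ ?_ ?_ (by simp)
  · refine this.congr fun i => ?_
    simp only [E]
    rw [List.take_of_length_le]
    simp
  · intro s hs
    simp only [List.mem_cons, List.not_mem_nil, or_false] at hs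
    rcases hs with rfl | rfl
    · exact nil.congr fun i => by simp [E]
    · simpa using hm
  · intro s hs
    simp only [List.mem_cons, List.not_mem_nil, or_false] at hs
    rcases hs with rfl | rfl
    · have hmask := head (var (O := O)
        (Γ := (fun x : {x : ι × ℕ // x.2 < (D x.1).length} => (D x.1.1).getD x.1.2 []) ::
          (pull (fun x => x.1.1) Γ ++
            pull (fun x => x.1) [fun x => (E x).flatten, fun x => (m x.1).drop x.2]))
        (f := fun x => (m x.1.1).drop x.1.2) (by simp))
      have hacc := var (O := O)
        (Γ := (fun x : {x : ι × ℕ // x.2 < (D x.1).length} => (D x.1.1).getD x.1.2 []) ::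
          (pull (fun x => x.1.1) Γ ++
            pull (fun x => x.1) [fun x => (E x).flatten, fun x => (m x.1).drop x.2]))
        (f := fun x => (E x.1).flatten) (by simp)
      have hch := flipLast (var (O := O)
        (Γ := (fun x : {x : ι × ℕ // x.2 < (D x.1).length} => (D x.1.1).getD x.1.2 []) ::
          (pull (fun x => x.1.1) Γ ++
            pull (fun x => x.1) [fun x => (E x).flatten, fun x => (m x.1).drop x.2]))
        (f := fun x => (D x.1.1).getD x.1.2 []) (by simp))
      have hn' : CompN O ((fun x : {x : ι × ℕ // x.2 < (D x.1).length} =>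
          (D x.1.1).getD x.1.2 []) :: (pull (fun x => x.1.1) Γ ++
            pull (fun x => x.1) [fun x => (E x).flatten, fun x => (m x.1).drop x.2]))
          (fun x => n x.1.1) := mono
          (reindex hn (fun x : {x : ι × ℕ // x.2 < (D x.1).length} => x.1.1)) fun g hg =>
            List.mem_cons_of_mem _ (List.mem_append_left _ hg)
      have hmem := memChunks (D := fun x : {x : ι × ℕ // x.2 < (D x.1).length} => E x.1)
        (fun x => hE x.1) hn' hacc hch
      refine (ite (hmask.and hmem.not) (hacc.append hch) hacc).congr fun x => ?_
      obtain ⟨⟨i, j⟩, hx⟩ := x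
      replace hx : j < (D i).length := hx
      have hx' : j < (m i).length := lt_of_lt_of_le hx (hml i)
      have hz : j < ((D i).zip (m i)).length := by simp; omega
      simp only [E, List.take_add_one, List.foldl_append, List.getElem?_eq_getElem hz,
        List.getElem_zip, List.drop_eq_getElem_cons hx', List.headD_cons,
        List.getD_eq_getElem _ _ hx]
      simp only [Option.toList, List.foldl_cons, List.foldl_nil, pick]
      split_ifs <;> simp
    · exact (tail (var (f := fun x => (m x.1.1).drop x.1.2) (by simp))).congr fun x => by simp
  · intro s hs
    simp only [List.mem_cons, List.not_mem_nil, or_false] at hs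
    rcases hs with rfl | rfl
    · refine PolyLe.mono (fun x => ?_)
        (hDc.polyLe.reindex (fun x : {x : ι × ℕ // x.2 ≤ (D x.1).length} => x.1.1))
      rw [length_flatten_chunks (hD _), length_flatten_chunks (hE _)]
      refine Nat.mul_le_mul_right _ ((length_foldl_pick _ _).trans ?_)
      simp
    · refine PolyLe.mono (fun x => ?_)
        (hm.polyLe.reindex (fun x : {x : ι × ℕ // x.2 ≤ (D x.1).length} => x.1.1))
      simp

end Comp

end StackMachine

namespace StackMachine

/-! ### Datasets as lists of chunks -/

/-- A labeled point as a string. -/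
def encPoint {n : ℕ} (z : Bits n × Bool) : List Bool := List.ofFn z.1 ++ [z.2]

/-- The labeled point described by a string. -/
def toPoint (n : ℕ) (c : List Bool) : Bits n × Bool := (fun k => c.getD k false, c.getD n false)

/-- The same point with the other label. -/
def flipLabel {n : ℕ} (z : Bits n × Bool) : Bits n × Bool := (z.1, !z.2)

theorem length_encPoint {n : ℕ} (z : Bits n × Bool) : (encPoint z).length = n + 1 := by
  simp [encPoint]

theorem toPoint_encPoint {n : ℕ} (z : Bits n × Bool) : toPoint n (encPoint z) = z := by
  obtain ⟨x, y⟩ := z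
  refine Prod.ext (funext fun k => ?_) ?_
  · simp [toPoint, encPoint]
  · simp [toPoint, encPoint]

theorem encPoint_injective {n : ℕ} : Function.Injective (encPoint (n := n)) :=
  Function.LeftInverse.injective (g := toPoint n) toPoint_encPoint

theorem encPoint_toPoint {n : ℕ} {c : List Bool} (h : c.length = n + 1) :
    encPoint (toPoint n c) = c := by
  refine List.ext_getElem (by rw [length_encPoint, h]) fun k h1 h2 => ?_
  simp only [encPoint, toPoint, List.getElem_append, List.length_ofFn, List.getElem_ofFn,
    List.getElem_singleton]
  split_ifs with hk
  · exact List.getD_eq_getElem _ _ h2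
  · obtain rfl : k = n := by omega
    exact List.getD_eq_getElem _ _ h2

theorem flipLast_encPoint {n : ℕ} (z : Bits n × Bool) :
    flipLast (encPoint z) = encPoint (flipLabel z) := flipLast_append _ _

theorem encodeData_eq {n : ℕ} (T : Dataset n) : encodeData T = (T.map encPoint).flatten := rfl

theorem encodeData_map_toPoint {n : ℕ} {D : List (List Bool)} (h : ∀ c ∈ D, c.length = n + 1) :
    encodeData (D.map (toPoint n)) = D.flatten := by
  rw [encodeData_eq, List.map_map]
  congr 1
  refine (List.map_congr_left fun c hc => ?_).trans (List.map_id D)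
  exact encPoint_toPoint (h c hc)

/-- The first `N` chunks of length `k` of a string. -/
def chunks (k : ℕ) : ℕ → List Bool → List (List Bool)
  | 0, _ => []
  | N + 1, l => l.take k :: chunks k N (l.drop k)

theorem length_chunks (k N : ℕ) (l : List Bool) : (chunks k N l).length = N := by
  induction N generalizing l with
  | zero => rfl
  | succ N ih => simp [chunks, ih]

theorem length_of_mem_chunks {k N : ℕ} {l : List Bool} (h : l.length = N * k) :
    ∀ c ∈ chunks k N l, c.length = k := by
  induction N generalizing l with
  | zero => simp [chunks]
  | succ N ih =>
    rw [Nat.succ_mul] at h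
    intro c hc
    rcases List.mem_cons.1 hc with rfl | hc
    · simp
      omega
    · exact ih (by simp; omega) c hc

theorem flatten_chunks {k N : ℕ} {l : List Bool} (h : l.length = N * k) :
    (chunks k N l).flatten = l := by
  induction N generalizing l with
  | zero => simpa [chunks, eq_comm] using h
  | succ N ih =>
    rw [Nat.succ_mul] at h
    rw [chunks, List.flatten_cons, ih (by simp; omega), List.take_append_drop]

theorem chunks_flatten {k : ℕ} {D : List (List Bool)} (h : ∀ c ∈ D, c.length = k) :
    chunks k D.length D.flatten = D := by
  induction D with
  | nil => rfl
  | cons c D ih =>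
    obtain rfl := h c (by simp)
    simp [chunks, ih fun d hd => h d (by simp [hd])]

/-- The first `k` bits, padded with `false` if there are less of them. -/
def padTo (k : ℕ) (l : List Bool) : List Bool := (l ++ List.replicate k false).take k

@[simp] theorem length_padTo (k : ℕ) (l : List Bool) : (padTo k l).length = k := by
  simp [padTo]

theorem padTo_of_length {k : ℕ} {l : List Bool} (h : l.length = k) : padTo k l = l := by
  subst h
  simp [padTo]

/-! ### Running a learner -/

variable {O : Set (List Bool)} {ι : Type} {F : ConceptClass} (A : Learner F)

/-- Some program simulates `A`, with the oracle `O`. -/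
def Simulates (O : Set (List Bool)) (A : Learner F) : Prop :=
  PolyTime O
    (ι := {i : (Σ n : ℕ, Dataset n) × ℚ × List Bool //
      0 < i.2.1 ∧ i.2.2.length = A.randLen i.1.1 i.1.2.length i.2.1})
    (fun i => [List.replicate i.1.1.1 true, encodeData i.1.1.2, i.1.2.2] ++ encodeRat i.1.2.1)
    (fun i => List.ofFn (A.run i.1.1.1 i.1.1.2 i.1.2.1 i.1.2.2))

variable {A} {Γ : List (ι → List Bool)}

theorem Simulates.comp_run (hA : Simulates O A) {n : ι → ℕ} {T : (i : ι) → Dataset (n i)}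
    {q : ι → ℚ} {r : ι → List Bool} (hq : ∀ i, 0 < q i)
    (hr : ∀ i, (r i).length = A.randLen (n i) (T i).length (q i))
    (cn : CompN O Γ n) (cT : Comp O Γ (fun i => encodeData (T i))) (cr : Comp O Γ r)
    (cnum : CompN O Γ (fun i => (q i).num.toNat)) (cden : CompN O Γ (fun i => (q i).den)) :
    Comp O Γ (fun i => List.ofFn (A.run (n i) (T i) (q i) (r i))) := by
  have h := Comp.ofPolyTime (Γ := [fun i => List.replicate i.1.1.1 true,
    fun i => encodeData i.1.1.2, fun i => i.1.2.2,
    fun i => List.replicate i.1.2.1.num.toNat true, fun i => List.replicate i.1.2.1.den true]) hA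
    (fun i => rfl)
  refine h.call (fun i => ⟨(⟨n i, T i⟩, q i, r i), hq i, hr i⟩) ?_
  intro a ha
  simp only [List.mem_cons, List.not_mem_nil, or_false] at ha
  rcases ha with rfl | rfl | rfl | rfl | rfl
  exacts [cn, cT, cr, cnum, cden]

/-! ### The verifier -/

/-- The points of a dataset (a string of `N` chunks of length `n + 1`) that are marked in `mask`,
with the other label. -/
def selected (n N : ℕ) (data mask : List Bool) : List (List Bool) :=
  ((chunks (n + 1) N (padTo (N * (n + 1)) data)).zip (padTo N mask)).foldl pick []

variable (A) in
/-- With the certificate `a, b, mask, r`: is `num / den` a fraction in lowest terms, is the number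
of selected points at least `N * bd / bn`, and does `A` output `α` on them? -/
noncomputable def verdict (n N : ℕ) (data : List Bool) (num den bn bd : ℕ) (α : List Bool)
    (a b : ℕ) (mask r : List Bool) : Bool :=
  (decide (a * num = b * den + 1) && decide (1 ≤ den)) &&
    (decide (N * bd ≤ (selected n N data mask).length * bn) &&
    decide (List.ofFn (A.run n ((selected n N data mask).map (toPoint n)) ((num : ℚ) / den)
      (padTo (A.ρ.eval (n + (selected n N data mask).length + num + den)) r)) = α))

theorem length_of_mem_selected {n N : ℕ} {data mask c : List Bool}
    (h : c ∈ selected n N data mask) : c.length = n + 1 := by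
  rcases mem_foldl_pick h with h | ⟨z, hz, rfl⟩
  · simp at h
  · exact length_flipLast (length_of_mem_chunks (by simp) _ (List.of_mem_zip hz).1)

/-- The Bézout identity certifies coprimality without computing a gcd, and forces `num` to be
positive. So the two numbers are exactly the encoding of their quotient, as the specification of `A`
requires. -/
theorem num_den_of_bezout {a b num den : ℕ} (h : a * num = b * den + 1) (hden : 1 ≤ den) :
    0 < (num : ℚ) / den ∧ ((num : ℚ) / den).num.toNat = num ∧ ((num : ℚ) / den).den = den := by
  have hnum : 0 < num := by
    rcases Nat.eq_zero_or_pos num with rfl | h'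
    · simp at h
    · exact h'
  have hc : Nat.Coprime num den := by
    refine Nat.dvd_one.1 ((Nat.dvd_add_right
      (dvd_mul_of_dvd_right (Nat.gcd_dvd_right num den) b)).1 ?_)
    exact h ▸ dvd_mul_of_dvd_right (Nat.gcd_dvd_left num den) a
  refine ⟨by positivity, ?_, ?_⟩
  · have := Rat.num_div_eq_of_coprime (a := num) (b := den) (by exact_mod_cast hden) (by simpa using hc)
    simp only [Int.cast_natCast] at this
    rw [this]
    simp
  · have := Rat.den_div_eq_of_coprime (a := num) (b := den) (by exact_mod_cast hden) (by simpa using hc)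
    simp only [Int.cast_natCast] at this
    exact_mod_cast this

theorem comp_selected {n N : ι → ℕ} {data mask : ι → List Bool} (cn : CompN O Γ n)
    (cN : CompN O Γ N) (cd : Comp O Γ data) (cm : Comp O Γ mask) :
    Comp O Γ (fun i => (selected (n i) (N i) (data i) (mask i)).flatten) := by
  refine Comp.pickChunks (n := n) (fun i => length_of_mem_chunks (by simp)) cn ?_
    (m := fun i => padTo (N i) (mask i)) (cm.takePad cN) (fun i => by simp [length_chunks])
  refine (cd.takePad (cN.mul cn.succ)).congr fun i => ?_
  rw [flatten_chunks (by simp)]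
  rfl

/-- The verifier must run in polynomial time on arbitrary strings, while `A` is controlled only on
genuine encodings. Hence the split on the Bézout test; padding of data, mask and random string takes
care of the lengths. -/
theorem Simulates.comp_verdict (hA : Simulates O A) {n N num den bn bd a b : ι → ℕ}
    {data α mask r : ι → List Bool} (cn : CompN O Γ n) (cN : CompN O Γ N) (cd : Comp O Γ data)
    (cnum : CompN O Γ num) (cden : CompN O Γ den) (cbn : CompN O Γ bn) (cbd : CompN O Γ bd)
    (cα : Comp O Γ α) (ca : CompN O Γ a) (cb : CompN O Γ b) (cm : Comp O Γ mask)
    (cr : Comp O Γ r) :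
    Comp O Γ (fun i => [verdict A (n i) (N i) (data i) (num i) (den i) (bn i) (bd i) (α i)
      (a i) (b i) (mask i) (r i)]) := by
  have cvalid : Comp O Γ (fun i => [decide (a i * num i = b i * den i + 1) &&
      decide (1 ≤ den i)]) :=
    ((ca.mul cnum).decideEq (cb.mul cden).succ).and ((CompN.const 1).decideLe cden)
  refine cvalid.split ?_ ((Comp.const [false]).congr fun x => ?_)
  · have csel := comp_selected cn cN cd cm
    have ccount := Comp.countChunks (D := fun i => selected (n i) (N i) (data i) (mask i))
      (fun i c hc => length_of_mem_selected hc) cn csel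
    have clen := CompN.eval A.ρ (((cn.add ccount).add cnum).add cden)
    let φ : {i // (decide (a i * num i = b i * den i + 1) && decide (1 ≤ den i)) = true} → ι :=
      fun x => x.1
    have hvalid : ∀ x : {i // (decide (a i * num i = b i * den i + 1) &&
        decide (1 ≤ den i)) = true}, 0 < (num x.1 : ℚ) / den x.1 ∧
          ((num x.1 : ℚ) / den x.1).num.toNat = num x.1 ∧
          ((num x.1 : ℚ) / den x.1).den = den x.1 := by
      intro x
      have hx := x.2
      simp only [Bool.and_eq_true, decide_eq_true_eq] at hx
      exact num_den_of_bezout hx.1 hx.2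
    have crun := hA.comp_run (Γ := pull φ Γ) (n := fun x => n x.1)
      (T := fun x => (selected (n x.1) (N x.1) (data x.1) (mask x.1)).map (toPoint (n x.1)))
      (q := fun x => (num x.1 : ℚ) / den x.1)
      (r := fun x => padTo (A.ρ.eval (n x.1 + (selected (n x.1) (N x.1) (data x.1)
        (mask x.1)).length + num x.1 + den x.1)) (r x.1))
      (fun x => (hvalid x).1) (fun x => by
        rw [length_padTo, Learner.randLen, List.length_map, (hvalid x).2.1, (hvalid x).2.2])
      (cn.reindex φ) ((csel.reindex φ).congr fun x => by
        rw [encodeData_map_toPoint fun c hc => length_of_mem_selected hc])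
      ((cr.takePad clen).reindex φ)
      (CompN.congr (cnum.reindex φ) fun x => (hvalid x).2.1.symm)
      (CompN.congr (cden.reindex φ) fun x => (hvalid x).2.2.symm)
    refine (((((cN.mul cbd).decideLe (ccount.mul cbn)).reindex φ).and
      (crun.decideEq (cα.reindex φ)))).congr fun x => ?_
    rw [verdict, x.2, Bool.true_and]
  · rw [verdict, x.2, Bool.false_and]

variable (A) in
/-- The verifier for the question whether there is a large subset of a dataset such that `A`
outputs a given concept on this subset with flipped labels. -/
noncomputable def verifier (x w : List Bool) : Bool :=
  x.headD false && verdict A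
    (decHead x.tail).length
    (decHead (decTail x.tail)).length
    (decHead (decTail (decTail x.tail)))
    (decHead (decTail (decTail (decTail x.tail)))).length
    (decHead (decTail (decTail (decTail (decTail x.tail))))).length
    (decHead (decTail (decTail (decTail (decTail (decTail x.tail)))))).length
    (decHead (decTail (decTail (decTail (decTail (decTail (decTail x.tail))))))).length
    (decHead (decTail (decTail (decTail (decTail (decTail (decTail (decTail x.tail))))))))
    (decHead w).length (decHead (decTail w)).length (decHead (decTail (decTail w)))
    (decHead (decTail (decTail (decTail w))))

theorem Simulates.polyTime_verifier (hA : Simulates O A) :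
    PolyTime O (fun xw : List Bool × List Bool => [xw.1, xw.2])
      (fun xw => [verifier A xw.1 xw.2]) := by
  refine Comp.toPolyTime (Γ := [fun xw => xw.1, fun xw => xw.2]) ?_ (fun _ => rfl)
  have cx : Comp O [fun xw : List Bool × List Bool => xw.1, fun xw => xw.2] (fun xw => xw.1) :=
    Comp.var (by simp)
  have cw : Comp O [fun xw : List Bool × List Bool => xw.1, fun xw => xw.2] (fun xw => xw.2) :=
    Comp.var (by simp)
  have c1 := cx.tail.decTail
  have c2 := c1.decTail
  have c3 := c2.decTail
  have c4 := c3.decTail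
  have c5 := c4.decTail
  have c6 := c5.decTail
  have c7 := c6.decTail
  exact cx.head.and (hA.comp_verdict cx.tail.decHead.length c1.decHead.length c2.decHead
    c3.decHead.length c4.decHead.length c5.decHead.length c6.decHead.length c7.decHead
    cw.decHead.length cw.decTail.decHead.length cw.decTail.decTail.decHead
    cw.decTail.decTail.decTail.decHead)

/-! ### The NP language and its certificates -/

variable (A) in
/-- The language decided by `verifier`, with certificates of polynomial length. -/
def oracle : Set (List Bool) :=
  {x | ∃ w : List Bool, w.length ≤ (6 * Polynomial.X + 2 * A.ρ + 4).eval x.length ∧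
    verifier A x w = true}

theorem inNP_oracle (hA : A.RunsInPolyTime) : InNP (oracle A) :=
  ⟨verifier A, Simulates.polyTime_verifier (O := ∅) hA, _, fun _ => Iff.rfl⟩

/-- The verifier tests the leading bit. This is the condition under which `polyTime_of_guarded`
simulates `A` in the presence of this oracle. -/
theorem false_cons_not_mem_oracle (l : List Bool) : false :: l ∉ oracle A := by
  rintro ⟨w, -, h⟩
  simp [verifier] at h

/-- The question asked about the candidate `α`. -/
def question {n m : ℕ} (T : Dataset n) (q β : ℚ) (α : Bits m) : List Bool :=
  true :: enc [List.replicate n true, List.replicate T.length true, encodeData T,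
    List.replicate q.num.toNat true, List.replicate q.den true,
    List.replicate β.num.toNat true, List.replicate β.den true, List.ofFn α]

theorem verifier_question {n m : ℕ} (T : Dataset n) (q β : ℚ) (α : Bits m) (w : List Bool) :
    verifier A (question T q β α) w = verdict A n T.length (encodeData T) q.num.toNat q.den
      β.num.toNat β.den (List.ofFn α) (decHead w).length (decHead (decTail w)).length
      (decHead (decTail (decTail w))) (decHead (decTail (decTail (decTail w)))) := by
  simp [verifier, question, decHead_enc, decTail_enc]

theorem chunks_encodeData {n : ℕ} (T : Dataset n) :
    chunks (n + 1) T.length (padTo (T.length * (n + 1)) (encodeData T)) = T.map encPoint := by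
  have h : ∀ c ∈ T.map (encPoint (n := n)), c.length = n + 1 := by
    intro c hc
    obtain ⟨z, -, rfl⟩ := List.mem_map.1 hc
    exact length_encPoint z
  rw [padTo_of_length (by
    rw [encodeData_eq, length_flatten_chunks h, List.length_map])]
  have := chunks_flatten h
  rwa [List.length_map] at this

theorem toNat_num_div_den {q : ℚ} (hq : 0 < q) : ((q.num.toNat : ℕ) : ℚ) / q.den = q := by
  have h : ((q.num.toNat : ℕ) : ℤ) = q.num := Int.toNat_of_nonneg (Rat.num_pos.2 hq).le
  have h' : ((q.num.toNat : ℕ) : ℚ) = (q.num : ℚ) := by exact_mod_cast h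
  rw [h', Rat.num_div_den]

/-- Reads an accepted certificate: `S` is the decoded selection, with labels already flipped. No
assumption that `T` is a set is needed, since `pick` removes repetitions. -/
theorem exists_of_mem_oracle {n : ℕ} {T : Dataset n} {q β : ℚ} {α : Bits (F.m n)} (hq : 0 < q)
    (h : question T q β α ∈ oracle A) :
    ∃ S : Dataset n, S.Nodup ∧ (∀ z ∈ S, flipLabel z ∈ T) ∧
      T.length * β.den ≤ S.length * β.num.toNat ∧
      ∃ r : List Bool, r.length = A.randLen n S.length q ∧ A.run n S q r = α := by
  obtain ⟨w, -, h⟩ := h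
  rw [verifier_question] at h
  set E := selected n T.length (encodeData T) (decHead (decTail (decTail w))) with hE
  simp only [verdict, Bool.and_eq_true, decide_eq_true_eq, ← hE] at h
  obtain ⟨⟨-, -⟩, hN, hrun⟩ := h
  have hEl : ∀ c ∈ E, c.length = n + 1 := fun c hc => length_of_mem_selected hc
  refine ⟨E.map (toPoint n), ?_, ?_, by simpa using hN, _, ?_, List.ofFn_injective
    ((toNat_num_div_den hq) ▸ hrun)⟩
  · refine List.Nodup.map_on ?_ (nodup_foldl_pick _ List.nodup_nil)
    intro c hc d hd hcd
    rw [← encPoint_toPoint (hEl c hc), hcd, encPoint_toPoint (hEl d hd)]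
  · intro z hz
    obtain ⟨c, hc, rfl⟩ := List.mem_map.1 hz
    rcases mem_foldl_pick hc with h | ⟨p, hp, rfl⟩
    · simp at h
    · have h1 := (List.of_mem_zip hp).1
      rw [chunks_encodeData] at h1
      obtain ⟨y, hy, hy'⟩ := List.mem_map.1 h1
      rw [← hy', flipLast_encPoint, toPoint_encPoint]
      simpa [flipLabel] using hy
  · simp [Learner.randLen]

/-- An inverse of the numerator modulo the denominator gives small coefficients, so the certificate
stays polynomial even in unary. Denominator 1, where residues carry no information, is handled
separately. -/
theorem exists_bezout {q : ℚ} (hq : 0 < q) : ∃ a b : ℕ, a * q.num.toNat = b * q.den + 1 ∧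
    a ≤ q.den ∧ b ≤ q.num.toNat := by
  have hc : Nat.Coprime q.num.toNat q.den := by
    have := q.reduced
    rwa [← Int.toNat_of_nonneg (Rat.num_pos.2 hq).le, Int.natAbs_natCast] at this
  have hnum : 0 < q.num.toNat := by
    have := Rat.num_pos.2 hq
    omega
  rcases Nat.lt_or_ge 1 q.den with h1 | h1
  · obtain ⟨a, ha, h⟩ := Nat.exists_mul_mod_eq_one_of_coprime hc h1
    refine ⟨a, q.num.toNat * a / q.den, ?_, ha.le, ?_⟩
    · have := Nat.div_add_mod (q.num.toNat * a) q.den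
      rw [h] at this
      rw [mul_comm a, mul_comm _ q.den]
      exact this.symm
    · exact Nat.div_le_of_le_mul (by rw [mul_comm]; gcongr)
  · have hd : q.den = 1 := le_antisymm h1 q.den_pos
    exact ⟨1, q.num.toNat - 1, by rw [hd]; omega, by omega, by omega⟩

theorem mem_oracle {n : ℕ} {T W : Dataset n} {q β : ℚ} {α : Bits (F.m n)} (hq : 0 < q)
    (hW : W.Sublist T) (hWn : W.Nodup) (hN : T.length * β.den ≤ W.length * β.num.toNat)
    {r : List Bool} (hr : r.length = A.randLen n W.length q)
    (hrun : A.run n (W.map flipLabel) q r = α) : question T q β α ∈ oracle A := by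
  obtain ⟨a, b, hab, ha, hb⟩ := exists_bezout hq
  have hflip : (W.map encPoint).map flipLast = (W.map flipLabel).map encPoint := by
    rw [List.map_map, List.map_map]
    exact List.map_congr_left fun z _ => flipLast_encPoint z
  obtain ⟨mask, hm, hpick⟩ := exists_mask (hW.map encPoint) (acc := []) (by
    rw [List.nil_append, hflip]
    refine (hWn.map ?_).map encPoint_injective
    rintro ⟨x, y⟩ ⟨x', y'⟩ h
    simpa [flipLabel] using h)
  rw [List.nil_append, hflip] at hpick
  rw [List.length_map] at hm
  have hsel : selected n T.length (encodeData T) mask = (W.map flipLabel).map encPoint := by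
    rw [selected, chunks_encodeData, padTo_of_length hm, hpick]
  have hT : ((W.map flipLabel).map encPoint).map (toPoint n) = W.map flipLabel := by
    rw [List.map_map]
    exact (List.map_congr_left fun z _ => toPoint_encPoint z).trans (List.map_id _)
  refine ⟨enc [List.replicate a true, List.replicate b true, mask, r], ?_, ?_⟩
  -- The encoding of four strings has twice their total length plus 4. The lengths of `a`, `b` and
  -- the mask are each at most that of the question, and `r` is at most `A.ρ` of it.
  · have h1 : W.length ≤ T.length := hW.length_le
    have h2 : n + T.length + q.num.toNat + q.den ≤ (question T q β α).length := by
      simp only [question, List.length_cons, length_enc, size_cons, List.length_replicate]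
      omega
    have h3 : r.length ≤ A.ρ.eval (question T q β α).length := by
      rw [hr]
      exact eval_mono _ (by omega)
    simp only [length_enc, size_cons, List.length_replicate, size_nil, List.length_cons,
      List.length_nil, Polynomial.eval_add, Polynomial.eval_mul, Polynomial.eval_X,
      Polynomial.eval_ofNat]
    omega
  · rw [verifier_question]
    simp only [decHead_enc, decTail_enc, verdict, hsel, hT, List.length_replicate, List.length_map,
      toNat_num_div_den hq, Bool.and_eq_true, decide_eq_true_eq]
    refine ⟨⟨hab, q.den_pos⟩, hN, ?_⟩
    rw [padTo_of_length (by simpa [Learner.randLen] using hr), hrun]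

end StackMachine

namespace StackMachine

/-! ### The verifiable learner -/

variable {O : Set (List Bool)} {F : ConceptClass}

/-- The error parameter, decreased to `1 / Q(n)` if it is larger. -/
def cap (Q : Polynomial ℕ) (n : ℕ) (ε : ℚ) : ℚ := min ε (1 / ((Q.eval n : ℕ) : ℚ))

/-- The output of `A` with a smaller error parameter, on the first part of the random string. -/
def candidate (A : Learner F) (Q : Polynomial ℕ) (n : ℕ) (T : Dataset n) (ε : ℚ) (r : List Bool) :
    Bits (F.m n) :=
  A.run n T (cap Q n ε) (r.take (A.randLen n T.length (cap Q n ε)))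

open Classical in
/-- Output the candidate, unless `A` outputs the candidate on a large subset of the dataset with
flipped labels. -/
noncomputable def verifiableLearner (A : Learner F) (Q : Polynomial ℕ) : VerifiableLearner F where
  ρ := A.ρ.comp (Polynomial.X + 1 + Q)
  run β n T ε r :=
    if question T (cap Q n ε) β (candidate A Q n T ε r) ∈ oracle A then none
    else some (candidate A Q n T ε r)

theorem run_eq_some {A : Learner F} {Q : Polynomial ℕ} {β : ℚ} {n : ℕ} {T : Dataset n} {ε : ℚ}
    {r : List Bool} {α : Bits (F.m n)} (h : candidate A Q n T ε r = α)
    (hα : question T (cap Q n ε) β α ∉ oracle A) :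
    (verifiableLearner A Q).run β n T ε r = some α := by
  subst h
  exact if_neg hα

/-! ### Arithmetic of the lowered error parameter -/

section Cap

variable {Q : Polynomial ℕ} {n : ℕ} {ε : ℚ}

theorem cap_pos (hQ : 1 ≤ Q.eval n) (hε : 0 < ε) : 0 < cap Q n ε :=
  lt_min hε (one_div_pos.2 (by exact_mod_cast hQ))

theorem num_den_one_div {k : ℕ} (hk : 1 ≤ k) :
    (1 / (k : ℚ)).num.toNat = 1 ∧ (1 / (k : ℚ)).den = k := by
  simpa using (num_den_of_bezout (a := 1) (b := 0) (num := 1) (by simp) hk).2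

/-- Cross-multiplication turns the minimum into a comparison of natural numbers, which the machine
can make in unary. -/
theorem cap_eq (hQ : 1 ≤ Q.eval n) (hε : 0 < ε) :
    cap Q n ε = if ε.num.toNat * Q.eval n ≤ ε.den then ε else 1 / ((Q.eval n : ℕ) : ℚ) := by
  have hQ' : (0 : ℚ) < (Q.eval n : ℕ) := by exact_mod_cast hQ
  have hd : (0 : ℚ) < ε.den := by exact_mod_cast ε.den_pos
  have h : ε ≤ 1 / ((Q.eval n : ℕ) : ℚ) ↔ ε.num.toNat * Q.eval n ≤ ε.den := by
    conv_lhs => rw [← toNat_num_div_den hε]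
    rw [div_le_div_iff₀ hd hQ', one_mul]
    exact_mod_cast Iff.rfl
  split_ifs with h'
  · exact min_eq_left (h.2 h')
  · exact min_eq_right (not_le.1 fun h'' => h' (h.1 h'')).le

theorem num_add_den_cap_le (hQ : 1 ≤ Q.eval n) (hε : 0 < ε) :
    (cap Q n ε).num.toNat + (cap Q n ε).den ≤ ε.num.toNat + ε.den + 1 + Q.eval n := by
  rw [cap_eq hQ hε]
  split_ifs
  · omega
  · rw [(num_den_one_div hQ).1, (num_den_one_div hQ).2]
    omega

/-- Either `ε` is kept, or numerator and denominator become `1` and `Q(n)`. The substitution `X + 1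
+ Q` in the new `ρ` covers both cases, so a prefix of the random string suffices for `A`. -/
theorem randLen_cap_le (A : Learner F) (hQ : 1 ≤ Q.eval n) (hε : 0 < ε) (β : ℚ) (N : ℕ) :
    A.randLen n N (cap Q n ε) ≤ (verifiableLearner A Q).randLen β n N ε := by
  unfold Learner.randLen VerifiableLearner.randLen verifiableLearner
  rw [Polynomial.eval_comp]
  refine eval_mono _ ?_
  have h1 := num_add_den_cap_le hQ hε
  have h2 := eval_mono Q (show n ≤ n + N + ε.num.toNat + ε.den + β.num.toNat + β.den by omega)
  simp only [Polynomial.eval_add, Polynomial.eval_X, Polynomial.eval_one]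
  omega

end Cap

theorem runsInPolyTime_verifiableLearner {A : Learner F} (hA : A.RunsInPolyTime)
    {Q : Polynomial ℕ} (hQ : ∀ n, 1 ≤ Q.eval n) :
    (verifiableLearner A Q).RunsInPolyTimeWithNPOracle := by
  classical
  refine ⟨oracle A, inNP_oracle hA, ?_⟩
  -- The program of `A` may itself contain queries, meant for the empty oracle; the guarded version
  -- answers them correctly under the NP oracle.
  have hsim : Simulates (oracle A) A := polyTime_of_guarded false_cons_not_mem_oracle hA
  let ι := {i : (Σ n : ℕ, Dataset n) × ℚ × ℚ × List Bool //
    1 ≤ i.2.1 ∧ 0 < i.2.2.1 ∧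
      i.2.2.2.length = (verifiableLearner A Q).randLen i.2.1 i.1.1 i.1.2.length i.2.2.1}
  let Γ : List (ι → List Bool) := [fun i => List.replicate i.1.1.1 true,
    fun i => encodeData i.1.1.2, fun i => i.1.2.2.2,
    fun i => List.replicate i.1.2.2.1.num.toNat true, fun i => List.replicate i.1.2.2.1.den true,
    fun i => List.replicate i.1.2.1.num.toNat true, fun i => List.replicate i.1.2.1.den true]
  refine Comp.toPolyTime (Γ := Γ) ?_ (fun _ => rfl)
  have cn : CompN (oracle A) Γ (fun i => i.1.1.1) := Comp.var (by simp [Γ])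
  have cT : Comp (oracle A) Γ (fun i => encodeData i.1.1.2) := Comp.var (by simp [Γ])
  have cr : Comp (oracle A) Γ (fun i => i.1.2.2.2) := Comp.var (by simp [Γ])
  have cnum : CompN (oracle A) Γ (fun i => i.1.2.2.1.num.toNat) := Comp.var (by simp [Γ])
  have cden : CompN (oracle A) Γ (fun i => i.1.2.2.1.den) := Comp.var (by simp [Γ])
  have cbn : CompN (oracle A) Γ (fun i => i.1.2.1.num.toNat) := Comp.var (by simp [Γ])
  have cbd : CompN (oracle A) Γ (fun i => i.1.2.1.den) := Comp.var (by simp [Γ])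
  have cQ := CompN.eval Q cn
  have cle := (cnum.mul cQ).decideLe cden
  have cnum' : CompN (oracle A) Γ (fun i => (cap Q i.1.1.1 i.1.2.2.1).num.toNat) := by
    refine (Comp.ite cle cnum (CompN.const 1)).congr fun i => ?_
    beta_reduce
    rw [cap_eq (hQ _) i.2.2.1]
    by_cases h : i.1.2.2.1.num.toNat * Q.eval i.1.1.1 ≤ i.1.2.2.1.den
    · simp [h]
    · simp only [h, decide_false, Bool.false_eq_true, if_false]
      rw [(num_den_one_div (hQ _)).1]
  have cden' : CompN (oracle A) Γ (fun i => (cap Q i.1.1.1 i.1.2.2.1).den) := by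
    refine (Comp.ite cle cden cQ).congr fun i => ?_
    beta_reduce
    rw [cap_eq (hQ _) i.2.2.1]
    by_cases h : i.1.2.2.1.num.toNat * Q.eval i.1.1.1 ≤ i.1.2.2.1.den
    · simp [h]
    · simp only [h, decide_false, Bool.false_eq_true, if_false]
      rw [(num_den_one_div (hQ _)).2]
  have cN : CompN (oracle A) Γ (fun i => i.1.1.2.length) := by
    refine (Comp.countChunks (D := fun i : ι => i.1.1.2.map encPoint) (fun i c hc => ?_) cn
      cT).congr fun i => List.length_map _
    obtain ⟨z, -, rfl⟩ := List.mem_map.1 hc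
    exact length_encPoint z
  have clen : CompN (oracle A) Γ
      (fun i => A.randLen i.1.1.1 i.1.1.2.length (cap Q i.1.1.1 i.1.2.2.1)) :=
    CompN.eval A.ρ (((cn.add cN).add cnum').add cden')
  have ccand : Comp (oracle A) Γ
      (fun i => List.ofFn (candidate A Q i.1.1.1 i.1.1.2 i.1.2.2.1 i.1.2.2.2)) :=
    hsim.comp_run (n := fun i : ι => i.1.1.1) (T := fun i => i.1.1.2)
      (q := fun i => cap Q i.1.1.1 i.1.2.2.1)
      (r := fun i => i.1.2.2.2.take (A.randLen i.1.1.1 i.1.1.2.length (cap Q i.1.1.1 i.1.2.2.1)))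
      (fun i => cap_pos (hQ _) i.2.2.1) (fun i => by
        rw [List.length_take, i.2.2.2]
        exact min_eq_left (randLen_cap_le A (hQ _) i.2.2.1 _ _)) cn cT (cr.take clen) cnum' cden'
  have cquest : Comp (oracle A) Γ (fun i => question i.1.1.2 (cap Q i.1.1.1 i.1.2.2.1) i.1.2.1
      (candidate A Q i.1.1.1 i.1.1.2 i.1.2.2.1 i.1.2.2.2)) := by
    refine Comp.cons true ((Comp.enc (L := [fun i : ι => List.replicate i.1.1.1 true,
      fun i => List.replicate i.1.1.2.length true, fun i => encodeData i.1.1.2,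
      fun i => List.replicate (cap Q i.1.1.1 i.1.2.2.1).num.toNat true,
      fun i => List.replicate (cap Q i.1.1.1 i.1.2.2.1).den true,
      fun i => List.replicate i.1.2.1.num.toNat true, fun i => List.replicate i.1.2.1.den true,
      fun i => List.ofFn (candidate A Q i.1.1.1 i.1.1.2 i.1.2.2.1 i.1.2.2.2)]) ?_))
    intro f hf
    simp only [List.mem_cons, List.not_mem_nil, or_false] at hf
    rcases hf with rfl | rfl | rfl | rfl | rfl | rfl | rfl | rfl
    exacts [cn, cN, cT, cnum', cden', cbn, cbd, ccand]
  refine (Comp.ite cquest.query Comp.nil (ccand.cons true)).congr fun i => ?_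
  simp only [verifiableLearner, decide_eq_true_eq]
  split_ifs <;> rfl

/-! ### Uniform probabilities -/

theorem uniformProb_mono {Ω : Type} [Finite Ω] {p q : Ω → Prop} (h : ∀ ω, p ω → q ω) :
    uniformProb p ≤ uniformProb q := by
  unfold uniformProb
  gcongr
  exact Nat.card_le_card_of_injective (Subtype.map id h) (Subtype.map_injective h fun _ _ h => h)

/-- A prefix of a uniform string is uniform: every prefix has the same number of extensions. -/
theorem uniformProb_take {X : Type} [Finite X] {k K : ℕ} (h : k ≤ K)
    (p : X × List Bool → Prop) :
    uniformProb (fun ω : X × Bits K => p (ω.1, (List.ofFn ω.2).take k))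
      = uniformProb (fun ω : X × Bits k => p (ω.1, List.ofFn ω.2)) := by
  obtain ⟨d, rfl⟩ := Nat.exists_eq_add_of_le h
  let e : (X × Bits k) × Bits d ≃ X × Bits (k + d) :=
    (Equiv.prodAssoc _ _ _).trans (Equiv.prodCongr (Equiv.refl X) (Fin.appendEquiv k d))
  have he : ∀ ω, (List.ofFn (e ω).2).take k = List.ofFn ω.1.2 := by
    intro ω
    change (List.ofFn (Fin.append ω.1.2 ω.2)).take k = _
    rw [List.ofFn_fin_append, List.take_left' (by simp)]
  have h1 : Nat.card {ω : X × Bits (k + d) // p (ω.1, (List.ofFn ω.2).take k)}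
      = Nat.card {ω : X × Bits k // p (ω.1, List.ofFn ω.2)} * Nat.card (Bits d) := by
    rw [← Nat.card_prod]
    refine Nat.card_congr (((e.subtypeEquiv
      (p := fun ω => p (ω.1.1, List.ofFn ω.1.2)) fun ω => ?_).symm).trans
      (Equiv.prodSubtypeFstEquivSubtypeProd
        (p := fun ω : X × Bits k => p (ω.1, List.ofFn ω.2))))
    rw [he]
    rfl
  have h2 : Nat.card (X × Bits (k + d)) = Nat.card (X × Bits k) * Nat.card (Bits d) := by
    rw [← Nat.card_prod]
    exact Nat.card_congr e.symm
  have h3 : (Nat.card (Bits d) : ℝ) ≠ 0 := by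
    exact_mod_cast Nat.card_pos.ne'
  unfold uniformProb
  rw [h1, h2]
  push_cast
  exact mul_div_mul_right _ _ h3

/-! ### Correctness -/

/-- Distinct concepts differ on at least a third of the cube, so distance at most `1/3` would force
exactly a third. This is impossible because 3 does not divide `2 ^ n`. -/
theorem eq_of_dist_le {c : ℝ} (hc : 1 / 3 ≤ c) (hF : F.IsDistinct c) {n : ℕ}
    {α α' : Bits (F.m n)} (hα : α ∈ F.labels n) (hα' : α' ∈ F.labels n)
    (h : F.dist n α α' ≤ 1 / 3) : α = α' := by
  by_contra hne
  obtain ⟨S, hS, hSf⟩ := hF n α hα α' hα' hne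
  set k := Nat.card {x : Bits n // F.f n α x ≠ F.f n α' x} with hk
  have h1 : S.card ≤ k := by
    have := Nat.card_le_card_of_injective
      (fun x : S => (⟨x.1, hSf x.1 x.2⟩ : {x : Bits n // F.f n α x ≠ F.f n α' x}))
      (fun x y hxy => Subtype.ext (congrArg (fun z => z.1) hxy))
    exact (Nat.card_eq_fintype_card.trans (Fintype.card_coe S)).symm.le.trans this
  have h2 : F.dist n α α' = k / 2 ^ n := by
    simp [ConceptClass.dist, uniformProb, hk]
  have h3 : (0 : ℝ) < 2 ^ n := by positivity
  rw [h2, div_le_div_iff₀ h3 (by norm_num), one_mul] at h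
  have h4 := hc.trans hS
  rw [div_le_div_iff₀ (by norm_num) h3, one_mul] at h4
  have h5 : k * 3 ≤ 2 ^ n := by exact_mod_cast h
  have h6 : 2 ^ n ≤ S.card * 3 := by exact_mod_cast h4
  have h7 : 3 ∣ 2 ^ n := ⟨k, by omega⟩
  have := Nat.prime_three.dvd_of_dvd_pow h7
  omega

theorem dist_label_self (n : ℕ) (α : Bits (F.m n)) : F.dist n α α = 0 := by
  simp [ConceptClass.dist, uniformProb]

section Correctness

variable {A : Learner F} {B : ℕ → ℚ → ℝ → ℕ} {n : ℕ} {ε β : ℚ} {δ : ℝ} {T : Dataset n}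
  {α : Bits (F.m n)}

theorem toNat_num_eq {q : ℚ} (hq : 0 < q) : (q.num.toNat : ℚ) = q * q.den :=
  (div_eq_iff (by exact_mod_cast q.den_pos.ne')).1 (toNat_num_div_den hq)

/-- The origin of the sample size `βB`: a `1/β` fraction of it still has `B` points. -/
theorem le_length_of_large {b N k : ℕ} (hβ : 1 ≤ β) (hN : ⌈β * (b : ℚ)⌉₊ ≤ N)
    (hk : N * β.den ≤ k * β.num.toNat) : b ≤ k := by
  have hβ0 : 0 < β := by linarith
  have hd : (0 : ℚ) < β.den := by exact_mod_cast β.den_pos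
  have h1 : β * b ≤ N := Nat.ceil_le.1 hN
  have h2 : (N : ℚ) * β.den ≤ k * β.num.toNat := by exact_mod_cast hk
  rw [toNat_num_eq hβ0, ← mul_assoc] at h2
  have h4 : (N : ℚ) ≤ k * β := le_of_mul_le_mul_right h2 hd
  have h5 : (b : ℚ) ≤ k := le_of_mul_le_mul_left (by linarith) hβ0
  exact_mod_cast h5

theorem le_of_ceil_le {b N : ℕ} (hβ : 1 ≤ β) (hN : ⌈β * (b : ℚ)⌉₊ ≤ N) : b ≤ N := by
  have h1 : β * b ≤ N := Nat.ceil_le.1 hN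
  have h2 : (b : ℚ) ≤ β * b := le_mul_of_one_le_left (by positivity) hβ
  exact_mod_cast h2.trans h1

/-- A consistent `α` is wrong on every point of a flipped subset, so a positive answer would
contradict `hnever`. As `T` may have repetitions, this applies to random samples too. -/
theorem question_not_mem_oracle (hβ : 1 ≤ β) (hε : 0 < ε)
    (hnever : ∀ S : Dataset n, S.Nodup → B n ε δ ≤ S.length → ∀ α ∈ F.labels n,
      (∀ z ∈ S, z.2 ≠ F.f n α z.1) →
      ∀ r : List Bool, r.length = A.randLen n S.length ε → A.run n S ε r ≠ α)
    (hT : ⌈β * (B n ε δ : ℚ)⌉₊ ≤ T.length) (hα : α ∈ F.labels n) (hcons : F.Consistent n α T) :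
    question T ε β α ∉ oracle A := by
  intro h
  obtain ⟨S, hS, hST, hlen, r, hr, hrun⟩ := exists_of_mem_oracle hε h
  refine hnever S hS (le_length_of_large hβ hT hlen) α hα (fun z hz => ?_) r hr hrun
  have := hcons _ (hST z hz)
  simp only [flipLabel] at this
  rw [← this]
  exact (Bool.not_ne_self _).symm

/-- Contrapositive: if the points `W` mislabeled by `α` made up a fraction `1/β`, then `α` would be
consistent with `W` flipped, and `A` could output exactly `α` there, giving a certificate. -/
theorem exists_sublist_of_not_mem_oracle {c : ℝ} (hc : 1 / 3 ≤ c) (hF : F.IsDistinct c)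
    (hβ : 1 ≤ β) (hε : 0 < ε)
    (hproper : ∀ T : Dataset n, B n ε δ ≤ T.length →
      ∀ r : List Bool, r.length = A.randLen n T.length ε → A.run n T ε r ∈ F.labels n)
    (hclose : ∀ T : Dataset n, (T.map Prod.fst).Nodup → B n ε δ ≤ T.length →
      ∀ α ∈ F.labels n, F.Consistent n α T →
      ∃ r : List Bool, r.length = A.randLen n T.length ε ∧ F.dist n α (A.run n T ε r) ≤ 1 / 3)
    (hT : ⌈β * (B n ε δ : ℚ)⌉₊ ≤ T.length) (hTn : T.Nodup) (hα : α ∈ F.labels n)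
    (hq : question T ε β α ∉ oracle A) :
    ∃ T' : Dataset n, T'.Sublist T ∧
      (1 - 1 / (β : ℝ)) * (T.length : ℝ) ≤ (T'.length : ℝ) ∧ F.Consistent n α T' := by
  let good : Bits n × Bool → Bool := fun z => z.2 == F.f n α z.1
  refine ⟨T.filter good, List.filter_sublist, ?_, fun z hz => ?_⟩
  · set W := T.filter (fun z => !good z) with hW
    have hlen : T.length = (T.filter good).length + W.length :=
      (List.length_eq_length_filter_add good)
    have hsmall : ¬ T.length * β.den ≤ W.length * β.num.toNat := by
      intro hlarge
      have hWB : B n ε δ ≤ (W.map flipLabel).length := by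
        rw [List.length_map]
        exact le_length_of_large hβ hT hlarge
      have hWn : W.Nodup := hTn.filter _
      have hWf : ∀ z ∈ W, (!z.2) = F.f n α z.1 := by
        intro z hz
        have := (List.mem_filter.1 hz).2
        simp only [good, Bool.not_eq_true', beq_eq_false_iff_ne] at this
        cases h1 : z.2 <;> cases h2 : F.f n α z.1 <;> simp_all
      have hcons : F.Consistent n α (W.map flipLabel) := by
        intro z hz
        obtain ⟨y, hy, rfl⟩ := List.mem_map.1 hz
        exact hWf y hy
      -- On `W` the label is determined by the input, being the negation of `f^α`; so distinct
      -- points have distinct inputs, as `hclose` demands.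
      have hnodup : ((W.map flipLabel).map Prod.fst).Nodup := by
        rw [List.map_map]
        refine List.Nodup.map_on (fun y hy z hz hyz => ?_) hWn
        have hyz' : y.1 = z.1 := hyz
        refine Prod.ext hyz' ?_
        have := (hWf y hy).trans ((congrArg _ hyz').trans (hWf z hz).symm)
        simpa using this
      obtain ⟨r, hr, hd⟩ := hclose _ hnodup hWB α hα hcons
      have hrun := eq_of_dist_le hc hF hα (hproper _ hWB r hr) hd
      rw [List.length_map] at hr
      exact hq (mem_oracle hε List.filter_sublist hWn hlarge hr hrun.symm)
    have hβ0 : 0 < β := by linarith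
    have hd : (0 : ℚ) < β.den := by exact_mod_cast β.den_pos
    have h2 : (W.length : ℚ) * β.num.toNat < T.length * β.den := by
      exact_mod_cast not_le.1 hsmall
    rw [toNat_num_eq hβ0, ← mul_assoc] at h2
    have h4 : (W.length : ℚ) * β ≤ T.length := le_of_mul_le_mul_right h2.le hd
    have h5 : (W.length : ℝ) * β ≤ T.length := by exact_mod_cast h4
    have hβr : (0 : ℝ) < β := by exact_mod_cast hβ0
    have h6 : (W.length : ℝ) ≤ T.length / β := (le_div_iff₀ hβr).2 h5
    have h7 : (T.length : ℝ) = (T.filter good).length + W.length := by exact_mod_cast hlen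
    have h8 : (1 - 1 / (β : ℝ)) * T.length = T.length - T.length / β := by ring
    rw [h8]
    linarith
  · simpa [good] using (List.mem_filter.1 hz).2

theorem consistent_sample {N : ℕ} (X : Fin N → Bits n) : F.Consistent n α (F.sample n α X) := by
  intro z hz
  obtain ⟨i, rfl⟩ := List.mem_ofFn.1 hz
  rfl

end Correctness

theorem ceil_one_div_cap_le {Q : Polynomial ℕ} {n : ℕ} (hQ : 1 ≤ Q.eval n) {ε : ℚ} (hε : 0 < ε) :
    ⌈1 / cap Q n ε⌉₊ ≤ ⌈1 / ε⌉₊ + Q.eval n := by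
  rw [cap_eq hQ hε]
  split_ifs
  · omega
  · simp

end StackMachine

/-! ### The theorem -/

open StackMachine in
theorem mainTheorem7 (F : ConceptClass) (c : ℝ) (hc : 1 / 3 ≤ c) (hF : F.IsDistinct c)
    (A : Learner F) (B : ℕ → ℚ → ℝ → ℕ) (hA : IsApproxCorrect F A B) :
    ∃ εc : ℕ → ℚ, IsInversePoly (fun n => (εc n : ℝ)) ∧
      ∃ A' : VerifiableLearner F,
        IsApproxVerifiable F A' (fun β n ε δ => ⌈β * (B n (min ε (εc n)) δ : ℚ)⌉₊) := by
  obtain ⟨ε₁, ⟨p₁, hp₁⟩, hnever⟩ := hA.never_totally_incorrect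
  obtain ⟨ε₂, ⟨p₂, hp₂⟩, hclose⟩ := hA.sometimes_close
  -- The summands make `1 / Q(n)` at most `ε₁ n`, `ε₂ n` and `1/3` respectively.
  let Q : Polynomial ℕ := p₁ + p₂ + 3
  have hQe : ∀ n, Q.eval n = p₁.eval n + p₂.eval n + 3 := fun n => by simp [Q]
  have hQ : ∀ n, 1 ≤ Q.eval n := fun n => by rw [hQe]; omega
  have hQpos : ∀ n, (0 : ℝ) < (Q.eval n : ℕ) := fun n => by exact_mod_cast hQ n
  have hcapQ : ∀ n ε, ((cap Q n ε : ℚ) : ℝ) ≤ 1 / ((Q.eval n : ℕ) : ℝ) := by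
    intro n ε
    have : cap Q n ε ≤ 1 / ((Q.eval n : ℕ) : ℚ) := min_le_right _ _
    calc ((cap Q n ε : ℚ) : ℝ) ≤ ((1 / ((Q.eval n : ℕ) : ℚ) : ℚ) : ℝ) := by exact_mod_cast this
      _ = 1 / ((Q.eval n : ℕ) : ℝ) := by push_cast; rfl
  have hcap : ∀ n ε (e : ℝ) (p : Polynomial ℕ), 0 < e → 1 / e ≤ p.eval n →
      p.eval n ≤ Q.eval n → ((cap Q n ε : ℚ) : ℝ) ≤ e := by
    intro n ε e p he hpe hpQ
    refine (hcapQ n ε).trans ?_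
    rw [one_div_le (hQpos n) he]
    exact hpe.trans (by exact_mod_cast hpQ)
  have hcap₁ : ∀ n ε, ((cap Q n ε : ℚ) : ℝ) ≤ ε₁ n := fun n ε =>
    hcap n ε _ p₁ (hp₁ n).1 (hp₁ n).2 (by rw [hQe]; omega)
  have hcap₂ : ∀ n ε, ((cap Q n ε : ℚ) : ℝ) ≤ ε₂ n := fun n ε =>
    hcap n ε _ p₂ (hp₂ n).1 (hp₂ n).2 (by rw [hQe]; omega)
  have hcap₃ : ∀ n ε, ((cap Q n ε : ℚ) : ℝ) ≤ 1 / 3 := fun n ε =>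
    hcap n ε _ 3 (by norm_num) (by norm_num) (by rw [hQe]; simp)
  refine ⟨fun n => 1 / ((Q.eval n : ℕ) : ℚ), ⟨Q, fun n => ?_⟩, verifiableLearner A Q, ?_⟩
  · push_cast
    exact ⟨one_div_pos.2 (hQpos n), by simp⟩
  change IsApproxVerifiable F (verifiableLearner A Q)
    (fun β n ε δ => ⌈β * (B n (cap Q n ε) δ : ℚ)⌉₊)
  refine ⟨?_, runsInPolyTime_verifiableLearner hA.time_poly hQ, ?_, ?_, ?_⟩
  · obtain ⟨p, hp⟩ := hA.size_poly
    -- The factor `X` absorbs `β`, and the argument `X + Q` absorbs `n`, `1/δ` and the inverse of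
    -- the lowered error.
    refine ⟨Polynomial.X * p.comp (Polynomial.X + Q), fun β n ε δ hβ hε hδ hδ1 => ?_⟩
    set s := n + ⌈1 / ε⌉₊ + ⌈1 / δ⌉₊ + ⌈β⌉₊ with hs
    have h1 := hp n (cap Q n ε) δ (cap_pos (hQ n) hε) hδ hδ1
    have h2 := ceil_one_div_cap_le (hQ n) hε
    have h3 : Q.eval n ≤ Q.eval s := eval_mono Q (by omega)
    have h4 : B n (cap Q n ε) δ ≤ p.eval (s + Q.eval s) :=
      h1.trans (eval_mono p (by omega))
    refine Nat.ceil_le.2 ?_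
    simp only [Polynomial.eval_mul, Polynomial.eval_comp, Polynomial.eval_add, Polynomial.eval_X]
    push_cast
    have h5 : β ≤ s := (Nat.le_ceil β).trans (by exact_mod_cast (by omega : ⌈β⌉₊ ≤ s))
    exact mul_le_mul h5 (by exact_mod_cast h4) (by positivity) (by positivity)
  · intro β hβ n ε δ hε hδ hδ1 α hα N hN
    have hBN : B n (cap Q n ε) δ ≤ N := le_of_ceil_le hβ hN
    have hpac := hA.pac n (cap Q n ε) δ (cap_pos (hQ n) hε) hδ hδ1 α hα N hBN
    have hle := randLen_cap_le A (hQ n) hε β N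
    refine hpac.trans ?_
    rw [← uniformProb_take hle (fun ω : (Fin N → Bits n) × List Bool => ∃ α' ∈ F.labels n,
      some (A.run n (F.sample n α ω.1) (cap Q n ε) ω.2) = some α' ∧
        F.dist n α α' ≤ ((cap Q n ε : ℚ) : ℝ))]
    refine uniformProb_mono ?_
    rintro ⟨X, ω⟩ ⟨α', hα', hrun, hd⟩
    -- An approximate success of `A` is an exact one, so the consistency of the sample with its
    -- target applies to the candidate.
    obtain rfl := eq_of_dist_le hc hF hα hα' (hd.trans (hcap₃ n ε))
    have hlen : (F.sample n α X).length = N := by simp [ConceptClass.sample]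
    have hcand : candidate A Q n (F.sample n α X) ε (List.ofFn ω) = α := by
      rw [candidate, hlen]
      exact Option.some.inj hrun
    refine ⟨α, hα, ?_, ?_⟩
    · have := question_not_mem_oracle (A := A) (T := F.sample n α X) hβ (cap_pos (hQ n) hε)
        (fun S hS hSB => hnever n _ δ (cap_pos (hQ n) hε) (hcap₁ n ε) hδ hδ1 S hS hSB)
        (by rw [hlen]; exact hN) hα (consistent_sample X)
      exact run_eq_some hcand this
    · rw [dist_label_self]
      exact_mod_cast hε.le
  · intro β n ε δ hβ hε hδ hδ1 T hT hTB r hr α hrun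
    have hBN : B n (cap Q n ε) δ ≤ T.length := le_of_ceil_le hβ hTB
    have hlen : (r.take (A.randLen n T.length (cap Q n ε))).length
        = A.randLen n T.length (cap Q n ε) := by
      rw [List.length_take, hr]
      exact min_eq_left (randLen_cap_le A (hQ n) hε β _)
    simp only [verifiableLearner] at hrun
    split_ifs at hrun with hq
    have hcand : candidate A Q n T ε r = α := Option.some.inj hrun
    rw [hcand] at hq
    have hα : α ∈ F.labels n := by
      rw [← hcand]
      exact hA.proper n _ δ (cap_pos (hQ n) hε) hδ hδ1 T hBN _ hlen
    exact ⟨hα, exists_sublist_of_not_mem_oracle hc hF hβ (cap_pos (hQ n) hε)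
      (hA.proper n _ δ (cap_pos (hQ n) hε) hδ hδ1)
      (hclose n _ δ (cap_pos (hQ n) hε) (hcap₂ n ε) hδ hδ1) hTB hT hα hq⟩
  · intro β n ε δ hβ hε hδ hδ1 T hT hTB α hα hcons
    have hε0 : 0 < ε := lt_of_lt_of_le (by norm_num) hε
    have hBN : B n (cap Q n ε) δ ≤ T.length := le_of_ceil_le hβ hTB
    -- A set consistent with a concept cannot contain the same input with two labels.
    have hnodup : (T.map Prod.fst).Nodup := by
      refine List.Nodup.map_on (fun y hy z hz hyz => Prod.ext hyz ?_) hT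
      rw [hcons y hy, hcons z hz, hyz]
    obtain ⟨r, hr, hd⟩ := hclose n _ δ (cap_pos (hQ n) hε0) (hcap₂ n ε) hδ hδ1 T hnodup hBN α hα
      hcons
    have hrun := eq_of_dist_le hc hF hα
      (hA.proper n _ δ (cap_pos (hQ n) hε0) hδ hδ1 T hBN r hr) hd
    have hle := randLen_cap_le A (hQ n) hε0 β T.length
    -- The new learner expects a longer random string but passes only a prefix to `A`; padding `r`
    -- on the right makes that prefix equal to `r`.
    refine ⟨padTo ((verifiableLearner A Q).randLen β n T.length ε) r, by simp, ?_⟩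
    have hcand : candidate A Q n T ε (padTo ((verifiableLearner A Q).randLen β n T.length ε) r)
        = α := by
      rw [candidate, padTo, List.take_take, min_eq_left hle, ← hr, List.take_left]
      exact hrun.symm
    have := question_not_mem_oracle (A := A) hβ (cap_pos (hQ n) hε0)
      (fun S hS hSB => hnever n _ δ (cap_pos (hQ n) hε0) (hcap₁ n ε) hδ hδ1 S hS hSB)
      hTB hα hcons
    exact run_eq_some hcand this
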